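/- A \emph{Cantor space} is a nonempty compact, metrizable, perfect, zero-dimensional space. A \emph{minimal Cantor system} $(X,T)$ is a Cantor space $X$ with a homeomorphism $T:X\to X$ all of whose orbits $\{T^n(x):n\in\mathbb{Z}\}$ are dense. Let $C(X,\mathbb{Z})$ be the group of continuous integer-valued functions on $X$, let $\mathrm{cob}(X,T)=\{f-f\circ T : f\in C(X,\mathbb{Z})\}$, and let $\mathcal{G}(X,T)=(G(X,T),G(X,T)_+,[1_X])$ be the unital dimension group with $G(X,T)=C(X,\mathbb{Z})/\mathrm{cob}(X,T)$, positive cone $G(X,T)_+=\{[f] : f\in C(X,\mathbb{Z}),\ f\ge 0\}$, and $[1_X]$ the class of the constant function $1$; write $a<b$ if $b-a\in G(X,T)_+\setminus\{0\}$. Let $(X,T)$ and $(Y,S)$ be minimal Cantor systems. The following are equivalent: \begin{enumerate} \item $(Y,S)$ is a strong speedup of $(X,T)$: there is a function $p:X\to\{1,2,3,\dots\}$ with at most one point of discontinuity such that $(Y,S)$ is topologically conjugate to $(X,T')$, where $T'(x)=T^{p(x)}(x)$ for all $x\in X$. \item There is an exhaustive epimorphism $\varphi:\mathcal{G}(Y,S)\to\mathcal{G}(X,T)$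 preserving the distinguished order unit, that is, a surjective group homomorphism $\varphi:G(Y,S)\to G(X,T)$ such that $\varphi(G(Y,S)_+)\subseteq G(X,T)_+$ and $\varphi([1_Y])=[1_X]$, and such that for all $g\in G(Y,S)_+$ and $h\in G(X,T)$ with $0<h<\varphi(g)$ there is $g'\in G(Y,S)$ with $\varphi(g')=h$ and $0<g'<g$. \item There is a homeomorphism $h:X\to Y$ such that $f\circ h\in\mathrm{cob}(X,T)$ whenever $f\in\mathrm{cob}(Y,S)$. \end{enumerate} -/

import Mathlib

/-- A Cantor space: a nonempty compact metrizable perfect zero-dimensional space, where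
zero-dimensional means that the clopen sets form a basis of the topology. -/
class IsCantorSpace (X : Type*) [TopologicalSpace X] : Prop where
  nonempty : Nonempty X
  compact : CompactSpace X
  metrizable : TopologicalSpace.MetrizableSpace X
  perfect : PerfectSpace X
  zeroDim : TopologicalSpace.IsTopologicalBasis {s : Set X | IsClopen s}

/-- A homeomorphism is minimal if every (two-sided) orbit is dense. -/
def IsMinimalHomeo {X : Type*} [TopologicalSpace X] (T : X ≃ₜ X) : Prop :=
  ∀ x : X, Dense {y : X | ∃ n : ℤ, y = (T ^ n : X ≃ₜ X) x}

/-- `(Y, S)` is a strong speedup of `(X, T)`: there is a jump function `p : X → {1, 2, …}` with at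
most one point of discontinuity such that `(Y, S)` is topologically conjugate to `(X, T')`, where
`T' x = T ^ (p x) x`. -/
def IsStrongSpeedup {X Y : Type*} [TopologicalSpace X] [TopologicalSpace Y]
    (S : Y ≃ₜ Y) (T : X ≃ₜ X) : Prop :=
  ∃ p : X → ℕ, (∀ x, 0 < p x) ∧ {x : X | ¬ ContinuousAt p x}.Subsingleton ∧
    ∃ h : X ≃ₜ Y, ∀ x : X, h (T^[p x] x) = S (h x)

/-- The subgroup of `T`-coboundaries `f - f ∘ T` in `C(X, ℤ)`. -/
def cob {X : Type*} [TopologicalSpace X] (T : X ≃ₜ X) : AddSubgroup C(X, ℤ) where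
  carrier := {g | ∃ f : C(X, ℤ), g = f - f.comp (T : C(X, X))}
  zero_mem' := ⟨0, by ext; simp⟩
  add_mem' := by
    rintro _ _ ⟨f, rfl⟩ ⟨g, rfl⟩
    exact ⟨f + g, by ext; simp; ring⟩
  neg_mem' := by
    rintro _ ⟨f, rfl⟩
    exact ⟨-f, by ext; simp; ring⟩

/-- The group `G(X, T)`, the quotient of `C(X, ℤ)` by the coboundaries. -/
abbrev DimGroup {X : Type*} [TopologicalSpace X] (T : X ≃ₜ X) : Type _ :=
  C(X, ℤ) ⧸ cob T

/-- The positive cone of `G(X, T)`: the classes of nonnegative functions. -/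
def posCone {X : Type*} [TopologicalSpace X] (T : X ≃ₜ X) : Set (DimGroup T) :=
  {a | ∃ f : C(X, ℤ), (∀ x, 0 ≤ f x) ∧ (QuotientAddGroup.mk f : DimGroup T) = a}

/-- The distinguished order unit of `G(X, T)`: the class of the constant function `1`. -/
def distUnit {X : Type*} [TopologicalSpace X] (T : X ≃ₜ X) : DimGroup T :=
  QuotientAddGroup.mk (1 : C(X, ℤ))

/-- The strict order of an abelian group with positive cone `P`: `a < b` if `b - a ∈ P \ {0}`. -/
def ConeLT {G : Type*} [AddCommGroup G] (P : Set G) (a b : G) : Prop :=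
  b - a ∈ P \ {0}

/-- `φ` is a unital epimorphism from `(G, P, u)` onto `(H, Q, v)`, where `P` and `Q` are the
positive cones and `u` and `v` the distinguished order units. -/
structure IsUnitalEpi {G H : Type*} [AddCommGroup G] [AddCommGroup H]
    (P : Set G) (u : G) (Q : Set H) (v : H) (φ : G →+ H) : Prop where
  surjective : Function.Surjective φ
  map_cone : φ '' P ⊆ Q
  map_unit : φ u = v

/-- `φ` is exhaustive: whenever `g` is in the positive cone of `G` and `0 < h < φ g` in `H`, there
is `g'` in `G` with `φ g' = h` and `0 < g' < g`. -/
def IsExhaustive {G H : Type*} [AddCommGroup G] [AddCommGroup H]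
    (P : Set G) (Q : Set H) (φ : G →+ H) : Prop :=
  ∀ g ∈ P, ∀ h : H, ConeLT Q 0 h → ConeLT Q h (φ g) →
    ∃ g' : G, φ g' = h ∧ ConeLT P 0 g' ∧ ConeLT P g' g

open Filter Topology Set

/-! ### Cantor spaces and minimal homeomorphisms -/

section Basic

variable {X Y : Type*} [TopologicalSpace X] [TopologicalSpace Y]

/-! All implications pass through condition 3. Conjugating `S` by `h` into a homeomorphism `R` of
`X`, that condition says that `u ∘ R - u` is a `T`-coboundary for every `u`, that is, `R ∈
trivialHomeos T`.

From 1 to 3: subtracting a constant, `u` may be assumed to vanish at the image of the one bad point.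
On the support of `u ∘ R` the jump function is then locally constant, and `R` is there a finite
patchwork of powers of `T` (`mem_trivialHomeos_of_speedup`).

Conditions 2 and 3: composition with `h` induces `φ`, and exhaustiveness is an interpolation
property of the dimension group: a class between `0` and `[F]` has a representative between `0` and
`F` (`IsMinimalHomeo.exists_mk_eq_and_le`). Conversely, `h` comes from a back-and-forth between
clopen partitions of `X` and `Y` whose pieces correspond under `φ`. A new clopen set of `Y` is
matched by strict positivity of `φ`, one of `X` by exhaustiveness (`exists_homeo_of_matchedCodes`).
Finitely determined side conditions, such as the images of two given points, can be imposed.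

From 3 to 1: equivalent clopen sets are exchanged by a locally constant positive power of `T`
(`IsMinimalHomeo.exists_bijOn_of_cl_eq`). Hence `R` can be replaced, piece by piece of a fine tower
partition, by positive powers of `T` outside a small roof, without changing how the pieces are
mapped. Below the roof the new map is conjugate to `R` by a homeomorphism preserving the partition
(`IsMinimalHomeo.exists_conj_isLocalPower`). Iterating with roofs shrinking to one point, the
conjugacies converge, and the conjugate of `S` is locally a positive power of `T` off that point. At
the point itself, the tracked points `x₀` and `x₁` force the conjugate to agree with `T`. -/

instance IsCantorSpace.instNonempty [h : IsCantorSpace X] : Nonempty X := h.nonempty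
instance IsCantorSpace.instCompactSpace [h : IsCantorSpace X] : CompactSpace X := h.compact
instance IsCantorSpace.instPerfectSpace [h : IsCantorSpace X] : PerfectSpace X := h.perfect
instance IsCantorSpace.instMetrizableSpace [h : IsCantorSpace X] :
    TopologicalSpace.MetrizableSpace X := h.metrizable
instance IsCantorSpace.instTotallySeparatedSpace [h : IsCantorSpace X] :
    TotallySeparatedSpace X :=
  totallySeparatedSpace_of_t0_of_basis_clopen h.zeroDim

instance IsCantorSpace.instCountableClopens [IsCantorSpace X] :
    Countable (TopologicalSpace.Clopens X) := by
  let := TopologicalSpace.metrizableSpaceMetric X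
  exact TopologicalSpace.Clopens.countable_iff_secondCountable.2 inferInstance

instance IsCantorSpace.instInfinite [IsCantorSpace X] : Infinite X := by
  obtain ⟨x⟩ : Nonempty X := inferInstance
  exact Set.infinite_univ_iff.1 (infinite_of_mem_nhds x univ_mem)

theorem IsCantorSpace.exists_isClopen_subset [h : IsCantorSpace X] {x : X} {U : Set X}
    (hU : IsOpen U) (hx : x ∈ U) : ∃ V : Set X, IsClopen V ∧ x ∈ V ∧ V ⊆ U := by
  obtain ⟨V, hV, hxV, hVU⟩ := h.zeroDim.exists_subset_of_mem_open hx hU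
  exact ⟨V, hV, hxV, hVU⟩

theorem IsCantorSpace.exists_isClopen_separating [IsCantorSpace X] {x y : X} (h : x ≠ y) :
    ∃ V : Set X, IsClopen V ∧ x ∈ V ∧ y ∉ V := by
  obtain ⟨V, hV, hx, hVU⟩ := exists_isClopen_subset (U := {y}ᶜ) isOpen_compl_singleton h
  exact ⟨V, hV, hx, fun hy => hVU hy rfl⟩

theorem homeo_pow_apply (T : X ≃ₜ X) (n : ℕ) (x : X) : (T ^ n : X ≃ₜ X) x = T^[n] x := by
  induction n generalizing x with
  | zero => rfl
  | succ n ih => rw [pow_succ, Homeomorph.mul_apply, ih, Function.iterate_succ_apply]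

theorem IsMinimalHomeo.inv {T : X ≃ₜ X} (hT : IsMinimalHomeo T) : IsMinimalHomeo T⁻¹ := by
  intro x
  refine (hT x).mono ?_
  rintro y ⟨n, rfl⟩
  exact ⟨-n, by rw [inv_zpow', neg_neg]⟩

theorem IsMinimalHomeo.conj {S : Y ≃ₜ Y} (hS : IsMinimalHomeo S) (h : X ≃ₜ Y) :
    IsMinimalHomeo ((h.trans S).trans h.symm) := by
  have key (n : ℤ) (x : X) :
      (((h.trans S).trans h.symm) ^ n : X ≃ₜ X) x = h.symm ((S ^ n : Y ≃ₜ Y) (h x)) := by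
    let φ : (Y ≃ₜ Y) →* (X ≃ₜ X) :=
      { toFun := fun S => (h.trans S).trans h.symm
        map_one' := by ext; simp
        map_mul' := by intro a b; ext; simp }
    exact (DFunLike.congr_fun (map_zpow φ S n) x).symm
  intro x
  refine ((hS (h x)).preimage h.isOpenMap).mono ?_
  rintro y ⟨n, hn⟩
  exact ⟨n, by rw [key, ← hn, h.symm_apply_apply]⟩

/-- Along a minimal homeomorphism, forward visits to a nonempty open set have bounded gaps. -/
theorem IsMinimalHomeo.exists_forall_visit [CompactSpace X] {T : X ≃ₜ X} (hT : IsMinimalHomeo T)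
    {U : Set X} (hU : IsOpen U) (hne : U.Nonempty) : ∃ N, ∀ x, ∃ i < N, T^[i] x ∈ U := by
  obtain ⟨s, hs⟩ := isCompact_univ.elim_finite_subcover (fun n : ℤ => (T ^ n : X ≃ₜ X) ⁻¹' U)
    (fun n => hU.preimage (T ^ n : X ≃ₜ X).continuous) (by
      intro x _
      obtain ⟨y, hy, n, rfl⟩ := (hT x).inter_open_nonempty U hU hne
      exact mem_iUnion.2 ⟨n, hy⟩)
  let M := s.sup Int.natAbs
  refine ⟨2 * M + 1, fun x => ?_⟩
  -- The finitely many exponents lie in `[-M, M]`; starting from `T ^ M x` shifts them into `[0,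
  -- 2M]`.
  have h1 := hs (mem_univ ((T ^ M : X ≃ₜ X) x))
  simp only [mem_iUnion, mem_preimage] at h1
  obtain ⟨n, hn, hx⟩ := h1
  have hle : n.natAbs ≤ M := Finset.le_sup (f := Int.natAbs) hn
  obtain ⟨i, hi⟩ : ∃ i : ℕ, (i : ℤ) = n + M := ⟨(n + M).toNat, by omega⟩
  refine ⟨i, by omega, ?_⟩
  rw [← homeo_pow_apply, ← zpow_natCast, hi, zpow_add, zpow_natCast]
  exact hx

/-- A periodic orbit would be a finite closed set that never meets its complement, which is open
and, `X` being infinite, nonempty. -/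
theorem IsMinimalHomeo.iterate_ne [IsCantorSpace X] {T : X ≃ₜ X} (hT : IsMinimalHomeo T)
    {n : ℕ} (hn : 0 < n) (x : X) : T^[n] x ≠ x := by
  intro h
  have hfin : ((fun i => T^[i] x) '' Iio n).Finite := (finite_Iio n).image _
  obtain ⟨N, hN⟩ := hT.exists_forall_visit hfin.isClosed.isOpen_compl
    hfin.infinite_compl.nonempty
  obtain ⟨i, -, hi⟩ := hN x
  exact hi ⟨i % n, Nat.mod_lt _ hn, Function.IsPeriodicPt.iterate_mod_apply h i⟩

theorem IsMinimalHomeo.iterate_injective [IsCantorSpace X] {T : X ≃ₜ X} (hT : IsMinimalHomeo T)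
    (x : X) : Function.Injective fun n : ℕ => T^[n] x := by
  have key {m n : ℕ} (hmn : m < n) : T^[m] x ≠ T^[n] x := by
    intro h
    rw [← Nat.add_sub_of_le hmn.le, Function.iterate_add_apply] at h
    refine hT.iterate_ne (Nat.sub_pos_of_lt hmn) x ?_
    exact ((T.injective.iterate m) h).symm
  intro m n h
  rcases lt_trichotomy m n with hl | hl | hl
  · exact (key hl h).elim
  · exact hl
  · exact (key hl h.symm).elim

/-! ### Coboundaries -/

theorem cob_mk_eq_iff {T : X ≃ₜ X} {f g : C(X, ℤ)} :
    (QuotientAddGroup.mk f : DimGroup T) = QuotientAddGroup.mk g ↔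
      ∃ c : C(X, ℤ), ∀ x, f x - g x = c x - c (T x) := by
  rw [QuotientAddGroup.eq_iff_sub_mem]
  constructor
  · rintro ⟨c, hc⟩
    exact ⟨c, fun x => by simpa using DFunLike.congr_fun hc x⟩
  · rintro ⟨c, hc⟩
    exact ⟨c, by ext x; simpa using hc x⟩

theorem cob_mk_eq_zero_iff {T : X ≃ₜ X} {f : C(X, ℤ)} :
    (QuotientAddGroup.mk f : DimGroup T) = 0 ↔ ∃ c : C(X, ℤ), ∀ x, f x = c x - c (T x) := by
  rw [← QuotientAddGroup.mk_zero, cob_mk_eq_iff]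
  simp

/-- A nonnegative coboundary of a minimal homeomorphism vanishes. -/
theorem IsMinimalHomeo.eq_zero_of_mk_eq_zero [CompactSpace X] {T : X ≃ₜ X}
    (hT : IsMinimalHomeo T) {f : C(X, ℤ)} (hf : ∀ x, 0 ≤ f x)
    (h : (QuotientAddGroup.mk f : DimGroup T) = 0) : f = 0 := by
  obtain ⟨c, hc⟩ := cob_mk_eq_zero_iff.1 h
  rcases isEmpty_or_nonempty X with hX | hX
  · ext x; exact (hX.false x).elim
  obtain ⟨m, -, hm⟩ := isCompact_univ.exists_isMinOn univ_nonempty c.continuous.continuousOn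
  have hm' : ∀ x, c m ≤ c x := fun x => hm (mem_univ x)
  -- As `f ≥ 0`, `c` does not increase along orbits, so it is constant on the forward orbit of a
  -- minimum; this orbit visits every nonempty level set.
  have hiter : ∀ i, c (T^[i] m) = c m := by
    intro i
    induction i with
    | zero => rfl
    | succ i ih =>
      rw [Function.iterate_succ_apply']
      have h1 := hc (T^[i] m)
      have h2 := hf (T^[i] m)
      have h3 := hm' (T (T^[i] m))
      omega
  have hconst : ∀ x, c x = c m := by
    intro x
    obtain ⟨N, hN⟩ := hT.exists_forall_visit (U := c ⁻¹' {c x})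
      ((isOpen_discrete _).preimage c.continuous) ⟨x, rfl⟩
    obtain ⟨i, -, hi⟩ := hN m
    rw [← hiter i]
    exact hi.symm
  ext x
  rw [hc x, hconst x, hconst (T x)]
  simp

theorem cob_sum_iterate {T : X ≃ₜ X} {f c : X → ℤ} (h : ∀ x, f x = c x - c (T x)) (n : ℕ) (x : X) :
    ∑ i ∈ Finset.range n, f (T^[i] x) = c x - c (T^[n] x) := by
  induction n with
  | zero => simp
  | succ n ih => rw [Finset.sum_range_succ, ih, h, Function.iterate_succ_apply']; ring

/-- Ergodic sums of a nonzero nonnegative function grow uniformly. -/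
theorem IsMinimalHomeo.exists_le_sum [CompactSpace X] {T : X ≃ₜ X} (hT : IsMinimalHomeo T)
    {f : C(X, ℤ)} (hf : ∀ x, 0 ≤ f x) (hne : f ≠ 0) (L : ℕ) :
    ∃ M, ∀ n ≥ M, ∀ x, (L : ℤ) ≤ ∑ i ∈ Finset.range n, f (T^[i] x) := by
  have hne' : (f ⁻¹' {0}ᶜ).Nonempty := by
    by_contra hcon
    rw [not_nonempty_iff_eq_empty, eq_empty_iff_forall_notMem] at hcon
    exact hne (by ext x; simpa using hcon x)
  obtain ⟨N, hN⟩ := hT.exists_forall_visit ((isOpen_discrete _).preimage f.continuous) hne'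
  have hmono (x : X) : Monotone fun n => ∑ i ∈ Finset.range n, f (T^[i] x) := by
    refine monotone_nat_of_le_succ fun n => ?_
    rw [Finset.sum_range_succ]
    linarith [hf (T^[n] x)]
  refine ⟨L * N, fun n hn x => le_trans ?_ (hmono x hn)⟩
  clear hn
  induction L with
  | zero => simp
  | succ L ih =>
    obtain ⟨i, hi, hx⟩ := hN (T^[L * N] x)
    beta_reduce at ih ⊢
    rw [add_mul, one_mul, Finset.sum_range_add]
    push_cast
    refine add_le_add ih ?_
    have h1 : 1 ≤ f (T^[L * N + i] x) := by
      have h2 := hf (T^[L * N + i] x)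
      rw [add_comm, Function.iterate_add_apply] at h2 ⊢
      have h3 : f (T^[i] (T^[L * N] x)) ≠ 0 := hx
      omega
    exact h1.trans (Finset.single_le_sum (f := fun i => f (T^[L * N + i] x)) (fun j _ => hf _)
      (Finset.mem_range.2 hi))

theorem ContinuousMap.exists_abs_le [CompactSpace X] (c : C(X, ℤ)) : ∃ K : ℕ, ∀ x, |c x| ≤ K := by
  obtain ⟨K, hK⟩ := (isCompact_range c.continuous.abs).bddAbove
  refine ⟨K.natAbs, fun x => ?_⟩
  have := hK (mem_range_self x)
  omega

end Basic

/-! ### Interpolation in the dimension group and equivalence of clopen sets -/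

section Comparison

variable {X Y : Type*} [TopologicalSpace X] [TopologicalSpace Y]

theorem sum_backward_iterate (T : X ≃ₜ X) (f : X → ℤ) (n : ℕ) (x : X) :
    ∑ i ∈ Finset.range n, f ((T⁻¹ : X ≃ₜ X)^[i] ((T⁻¹ : X ≃ₜ X) (T^[n] x))) =
      ∑ i ∈ Finset.range n, f (T^[i] x) := by
  have hT : ∀ y, (T⁻¹ : X ≃ₜ X) (T y) = y := T.symm_apply_apply
  induction n with
  | zero => simp
  | succ n ih =>
    rw [Finset.sum_range_succ', Finset.sum_range_succ, ← ih]
    simp only [Function.iterate_succ_apply, Function.iterate_zero, id]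
    simp only [← Function.iterate_succ_apply, Function.iterate_succ_apply' T, hT]

/-- If `0 ≤ [k] < [F]` and `F ≥ 0`, then `[k]` is represented by a function between `0` and `F`. -/
theorem IsMinimalHomeo.exists_mk_eq_and_le [CompactSpace X] {T : X ≃ₜ X} (hT : IsMinimalHomeo T)
    {F : C(X, ℤ)} (hF : ∀ x, 0 ≤ F x) {a : DimGroup T} (ha : a ∈ posCone T)
    (haF : ConeLT (posCone T) a (QuotientAddGroup.mk F)) :
    ∃ k : C(X, ℤ), QuotientAddGroup.mk k = a ∧ ∀ x, 0 ≤ k x ∧ k x ≤ F x := by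
  obtain ⟨k, hk, rfl⟩ := ha
  obtain ⟨⟨l, hl, hlF⟩, hne⟩ := haF
  have hl0 : l ≠ 0 := by
    rintro rfl
    exact hne hlF.symm
  rw [← QuotientAddGroup.mk_sub, eq_comm, cob_mk_eq_iff] at hlF
  obtain ⟨c, hc⟩ := hlF
  obtain ⟨K, hK⟩ := c.exists_abs_le
  obtain ⟨M, hM⟩ := hT.exists_le_sum hl hl0 (2 * K)
  -- `G n x` is the excess of demand `k` over capacity `F` during the last `n` steps before `x`. For
  -- `n ≥ M` it is not positive: the sums of `l` reach `2 * K`, which bounds the coboundary terms.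
  let G : ℕ → X → ℤ := fun n x =>
    ∑ i ∈ Finset.range n, (k - F) ((T⁻¹ : X ≃ₜ X)^[i] ((T⁻¹ : X ≃ₜ X) x))
  have hG0 (x) : G 0 x = 0 := by simp [G]
  have hGs (n x) : G (n + 1) (T x) = k x - F x + G n x := by
    have h1 : (T⁻¹ : X ≃ₜ X) (T x) = x := T.symm_apply_apply x
    simp only [G]
    rw [Finset.sum_range_succ', add_comm]
    simp [h1]
  have hGle (n) (hn : M ≤ n) (x) : G n x ≤ 0 := by
    obtain ⟨y, rfl⟩ := (T.surjective.iterate n) x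
    simp only [G]
    rw [sum_backward_iterate]
    have h1 := hM n hn y
    have h2 : ∑ i ∈ Finset.range n, (k - F) (T^[i] y) + ∑ i ∈ Finset.range n, l (T^[i] y)
        = - (c y - c (T^[n] y)) := by
      rw [← cob_sum_iterate (T := T) hc, ← Finset.sum_add_distrib, ← Finset.sum_neg_distrib]
      refine Finset.sum_congr rfl fun i _ => ?_
      simp only [ContinuousMap.sub_apply]
      ring
    have h3 := abs_le.1 (hK y)
    have h4 := abs_le.1 (hK (T^[n] y))
    push_cast at h1
    linarith
  have hGc (n) : Continuous (G n) := by
    refine continuous_finsetSum _ fun i _ => ?_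
    exact (k - F).continuous.comp
      (((T⁻¹ : X ≃ₜ X).continuous.iterate i).comp (T⁻¹ : X ≃ₜ X).continuous)
  have hne : (Finset.range (M + 1)).Nonempty := ⟨0, by simp⟩
  -- The backlog of a queue with demand `k` and capacity `F`: `q (T x) = max 0 (k x - F x + q x)`.
  -- The amount served, `k + q - q ∘ T`, equals `min (k + q) F`, hence lies between `0` and `F`.
  let q : C(X, ℤ) := ⟨fun x => (Finset.range (M + 1)).sup' hne fun n => G n x,
    Continuous.finset_sup'_apply hne fun n _ => hGc n⟩
  have hqle (x n) (hn : n ≤ M) : G n x ≤ q x :=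
    Finset.le_sup' (fun n => G n x) (Finset.mem_range.2 (Nat.lt_succ_of_le hn))
  have hq0 (x) : 0 ≤ q x := (hG0 x).symm.le.trans (hqle x 0 M.zero_le)
  have hqT (x) : k x - F x + q x ≤ q (T x) := by
    obtain ⟨n, hn, h⟩ := Finset.exists_mem_eq_sup' hne fun n => G n x
    have h' : q x = G n x := h
    rw [h', ← hGs]
    rcases Nat.lt_or_ge n M with h1 | h1
    · exact hqle _ _ h1
    · exact (hGle _ (by omega) _).trans (hq0 _)
  have hqT' (x) : q (T x) ≤ max 0 (k x - F x + q x) := by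
    refine Finset.sup'_le hne _ fun n hn => ?_
    rcases n with _ | n
    · rw [hG0]; exact le_max_left _ _
    · rw [hGs]
      exact le_max_of_le_right (by
        have := hqle x n (by have := Finset.mem_range.1 hn; omega)
        linarith)
  refine ⟨q + k - q.comp (T : C(X, X)), ?_, fun x => ?_⟩
  · rw [cob_mk_eq_iff]
    refine ⟨q, fun x => ?_⟩
    simp only [ContinuousMap.sub_apply, ContinuousMap.add_apply, ContinuousMap.comp_apply,
      ContinuousMap.coe_coe]
    ring
  · have h1 := hqT x
    have h2 := hqT' x
    have h3 := hq0 x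
    have h4 := hk x
    have h5 := hF x
    simp only [ContinuousMap.sub_apply, ContinuousMap.add_apply, ContinuousMap.comp_apply,
      ContinuousMap.coe_coe]
    rcases le_max_iff.1 h2 with h6 | h6 <;> constructor <;> linarith

theorem isLocallyConstant_find {P : X → ℕ → Prop} [∀ x, DecidablePred (P x)] (hP : ∀ n, IsClopen {x | P x n})
    (h : ∀ x, ∃ n, P x n) : IsLocallyConstant fun x => Nat.find (h x) := by
  rw [IsLocallyConstant.iff_isOpen_fiber]
  intro n
  have : (fun x => Nat.find (h x)) ⁻¹' {n} =
      {x | P x n} ∩ ⋂ m ∈ Finset.range n, {x | P x m}ᶜ := by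
    ext x
    simp [Nat.find_eq_iff]
  rw [this]
  exact (hP n).isOpen.inter
    (isOpen_biInter_finset fun m _ => (hP m).compl.isOpen)

open Classical in
/-- The indicator function of a clopen set as a continuous function (`0` if `V` is not clopen). -/
noncomputable def chi (V : Set X) : C(X, ℤ) :=
  if h : IsClopen V then
    ⟨fun x => if x ∈ V then 1 else 0,
      continuous_const.if (by simp [h.frontier_eq]) continuous_const⟩
  else 0

open Classical in
theorem chi_apply {V : Set X} (h : IsClopen V) (x : X) : chi V x = if x ∈ V then 1 else 0 := by
  simp [chi, h]

theorem chi_of_mem {V : Set X} (h : IsClopen V) {x : X} (hx : x ∈ V) : chi V x = 1 := by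
  simp [chi_apply h, hx]

theorem chi_of_notMem {V : Set X} (h : IsClopen V) {x : X} (hx : x ∉ V) : chi V x = 0 := by
  simp [chi_apply h, hx]

theorem chi_nonneg (V : Set X) (x : X) : 0 ≤ chi V x := by
  by_cases h : IsClopen V
  · rw [chi_apply h]; split_ifs <;> simp
  · simp [chi, h]

/-- The class of a clopen set in the dimension group. -/
noncomputable def cl (T : X ≃ₜ X) (V : Set X) : DimGroup T := QuotientAddGroup.mk (chi V)

theorem cl_empty (T : X ≃ₜ X) : cl T ∅ = 0 := by
  have : chi (∅ : Set X) = 0 := by ext x; simp [chi_apply isClopen_empty]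
  rw [cl, this, QuotientAddGroup.mk_zero]

theorem cl_univ (T : X ≃ₜ X) : cl T univ = distUnit T := by
  have : chi (univ : Set X) = 1 := by ext x; simp [chi_apply isClopen_univ]
  rw [cl, this, distUnit]

theorem cl_mem_posCone (T : X ≃ₜ X) (V : Set X) : cl T V ∈ posCone T :=
  ⟨chi V, chi_nonneg V, rfl⟩

theorem cl_union (T : X ≃ₜ X) {U V : Set X} (hU : IsClopen U) (hV : IsClopen V)
    (h : Disjoint U V) : cl T (U ∪ V) = cl T U + cl T V := by
  have : chi (U ∪ V) = chi U + chi V := by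
    ext x
    have : x ∈ U → x ∉ V := fun hx => Set.disjoint_left.1 h hx
    by_cases h1 : x ∈ U <;> by_cases h2 : x ∈ V <;>
      simp_all [chi_apply (hU.union hV), chi_apply hU, chi_apply hV]
  rw [cl, this, QuotientAddGroup.mk_add, cl, cl]

theorem cl_diff (T : X ≃ₜ X) {U V : Set X} (hU : IsClopen U) (hV : IsClopen V) :
    cl T (U \ V) = cl T U - cl T (U ∩ V) := by
  have h := cl_union T (hU.inter hV) (hU.diff hV) disjoint_sdiff_inter.symm
  rw [inter_union_sdiff] at h
  rw [h]; abel

theorem IsMinimalHomeo.cl_ne_zero [CompactSpace X] {T : X ≃ₜ X} (hT : IsMinimalHomeo T) {V : Set X}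
    (hV : IsClopen V) (hne : V.Nonempty) : cl T V ≠ 0 := by
  intro h
  obtain ⟨x, hx⟩ := hne
  have := DFunLike.congr_fun (hT.eq_zero_of_mk_eq_zero (chi_nonneg V) h) x
  rw [chi_of_mem hV hx] at this
  exact one_ne_zero this

/-- Equivalent clopen sets are matched by a locally constant positive power of `T`: regard the
points of `A` as arrivals and those of `B` as departures of a queue, first in, first out. -/
theorem IsMinimalHomeo.exists_bijOn_of_cl_eq [CompactSpace X] {T : X ≃ₜ X} (hT : IsMinimalHomeo T)
    {A B : Set X} (hA : IsClopen A) (hB : IsClopen B) (h : cl T A = cl T B) :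
    ∃ p : X → ℕ, IsLocallyConstant p ∧ (∀ x, 0 < p x) ∧ BijOn (fun x => T^[p x] x) A B := by
  classical
  rcases A.eq_empty_or_nonempty with rfl | hAne
  · have : B = ∅ := by
      by_contra hne
      exact hT.cl_ne_zero hB (nonempty_iff_ne_empty.2 hne) (h.symm.trans (cl_empty T))
    subst this
    exact ⟨fun _ => 1, IsLocallyConstant.const 1, fun _ => one_pos, bijOn_empty _⟩
  have hBne : B.Nonempty := by
    rw [nonempty_iff_ne_empty]
    rintro rfl
    exact hT.cl_ne_zero hA hAne (h.trans (cl_empty T))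
  have hA0 : chi A ≠ 0 := by
    intro h0
    exact hT.cl_ne_zero hA hAne (by rw [cl, h0, QuotientAddGroup.mk_zero])
  have hB0 : chi B ≠ 0 := by
    intro h0
    exact hT.cl_ne_zero hB hBne (by rw [cl, h0, QuotientAddGroup.mk_zero])
  obtain ⟨c, hc⟩ := cob_mk_eq_iff.1 h
  obtain ⟨K, hK⟩ := c.exists_abs_le
  -- The queue length, with `q ∘ T = q + chi A - chi B`. The extra `1` keeps the queue nonempty, so
  -- that no point departs at the moment it arrives and the power is positive.
  let q : X → ℤ := fun x => K + 1 - c x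
  have hqc : Continuous q := continuous_const.sub c.continuous
  have hq1 (x) : 1 ≤ q x := by
    have := (abs_le.1 (hK x)).2
    simp only [q]; linarith
  have hqn (n x) : q (T^[n] x) = q x + ∑ i ∈ Finset.range n, chi A (T^[i] x)
      - ∑ i ∈ Finset.range n, chi B (T^[i] x) := by
    rw [add_sub_assoc, ← Finset.sum_sub_distrib, cob_sum_iterate (T := T) hc]
    simp only [q]; ring
  let N : ℕ → X → ℤ := fun n x => ∑ i ∈ Finset.range n, chi B (T^[i] x)
  have hNs (n x) : N (n + 1) x = N n x + chi B (T^[n] x) := Finset.sum_range_succ _ _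
  have hNm (x) : Monotone fun n => N n x := by
    refine monotone_nat_of_le_succ fun n => ?_
    rw [hNs]
    linarith [chi_nonneg B (T^[n] x)]
  have hNc (n) : Continuous (N n) :=
    continuous_finsetSum _ fun i _ => (chi B).continuous.comp (T.continuous.iterate i)
  have hNadd (m n x) : N (m + n) x = N m x + N n (T^[m] x) := by
    simp only [N]
    rw [Finset.sum_range_add]
    simp only [add_comm m, Function.iterate_add_apply]
  -- An arrival at `x` finds `q x` others ahead, so it leaves at the visit to `B` preceded by
  -- exactly `q x` departures.
  let P : X → ℕ → Prop := fun x n => N n x = q x ∧ T^[n] x ∈ B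
  have hP (n) : IsClopen {x | P x n} :=
    ((isClopen_discrete {(0 : ℤ)}).preimage ((hNc n).sub hqc)).inter
      (hB.preimage (T.continuous.iterate n)) |> fun h => by
        convert h using 1
        ext x
        simp [P, sub_eq_zero]
  have hex (x) : ∃ n, P x n := by
    obtain ⟨M, hM⟩ := hT.exists_le_sum (chi_nonneg B) hB0 (q x + 1).toNat
    have h1 : ∃ n, q x < N n x := ⟨M, by
      have := hM M le_rfl x
      have h2 := hq1 x
      simp only [N]
      omega⟩
    obtain ⟨m, hm⟩ : ∃ m, Nat.find h1 = m + 1 := Nat.exists_eq_succ_of_ne_zero (by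
      intro h0
      have := Nat.find_spec h1
      rw [h0] at this
      have h2 := hq1 x
      simp only [N, Finset.range_zero, Finset.sum_empty] at this
      omega)
    have h2 := Nat.find_spec h1
    have h3 := Nat.find_min h1 (m := m) (by omega)
    rw [hm, hNs] at h2
    by_cases h4 : T^[m] x ∈ B
    · rw [chi_of_mem hB h4] at h2
      exact ⟨m, by omega, h4⟩
    · rw [chi_of_notMem hB h4] at h2
      omega
  have huniq {x m n} (hm : P x m) (hn : P x n) : m = n := by
    have key {m n} (hm : P x m) (hn : P x n) : ¬ m < n := by
      intro hlt
      have h1 := hNm x (show m + 1 ≤ n from hlt)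
      simp only [hNs] at h1
      rw [chi_of_mem hB hm.2, hm.1, hn.1] at h1
      omega
    exact le_antisymm (not_lt.1 (key hn hm)) (not_lt.1 (key hm hn))
  refine ⟨fun x => Nat.find (hex x), isLocallyConstant_find hP hex, fun x => ?_, ?_, ?_, ?_⟩
  · rw [Nat.find_pos]
    rintro ⟨h0, -⟩
    have := hq1 x
    simp only [N, Finset.range_zero, Finset.sum_empty] at h0
    omega
  · intro x _
    exact (Nat.find_spec (hex x)).2
  -- If both leave together and `y = T^[d] x`, the balance leaves no arrivals at times `0, …, d -
  -- 1`; but `x` itself arrives at time `0`, so `d = 0`.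
  · have key {x y} (hx : x ∈ A) {m n} (hm : P x m) (hn : P y n) (hmn : n ≤ m)
        (he : T^[m] x = T^[n] y) : x = y := by
      obtain ⟨d, rfl⟩ := Nat.exists_eq_add_of_le' hmn
      rw [add_comm, Function.iterate_add_apply] at he
      have hy := (T.injective.iterate n) he
      subst hy
      have h1 := hm.1
      rw [hNadd, hn.1, hqn] at h1
      have h2 : ∑ i ∈ Finset.range d, chi A (T^[i] x) = 0 := by
        simp only [N] at h1
        linarith
      rcases d with _ | d
      · rfl
      · have h3 := (Finset.sum_eq_zero_iff_of_nonneg fun i _ => chi_nonneg A _).1 h2 0 (by simp)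
        simp [chi_of_mem hA hx] at h3
    intro x hx y hy he
    rcases le_total (Nat.find (hex x)) (Nat.find (hex y)) with hle | hle
    · exact (key hy (Nat.find_spec (hex y)) (Nat.find_spec (hex x)) hle he.symm).symm
    · exact key hx (Nat.find_spec (hex x)) (Nat.find_spec (hex y)) hle he
  · intro y hy
    -- The departure at `y` is the oldest member of the queue, that is, the `q y`-th arrival counted
    -- backwards from just before `y`.
    let U : ℕ → ℤ := fun n =>
      ∑ i ∈ Finset.range n, chi A ((T⁻¹ : X ≃ₜ X)^[i] ((T⁻¹ : X ≃ₜ X) y))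
    obtain ⟨M, hM⟩ := hT.inv.exists_le_sum (chi_nonneg A) hA0 (q y).toNat
    have h1 : ∃ n, q y ≤ U n := ⟨M, by
      have := hM M le_rfl ((T⁻¹ : X ≃ₜ X) y)
      simp only [U]
      omega⟩
    obtain ⟨m, hm⟩ : ∃ m, Nat.find h1 = m + 1 := Nat.exists_eq_succ_of_ne_zero (by
      intro h0
      have := Nat.find_spec h1
      rw [h0] at this
      have h2 := hq1 y
      simp only [U, Finset.range_zero, Finset.sum_empty] at this
      omega)
    have h2 := Nat.find_spec h1
    have h3 := Nat.find_min h1 (m := m) (by omega)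
    rw [hm] at h2
    have h4 : U (m + 1) = U m + chi A ((T⁻¹ : X ≃ₜ X)^[m + 1] y) := Finset.sum_range_succ _ _
    set x := (T⁻¹ : X ≃ₜ X)^[m + 1] y with hxdef
    have hxA : x ∈ A := by
      by_contra h5
      rw [h4, chi_of_notMem hA h5] at h2
      omega
    have hxy : T^[m + 1] x = y :=
      (Function.LeftInverse.iterate (g := T) (f := (T⁻¹ : X ≃ₜ X)) T.apply_symm_apply (m + 1)) y
    have hU : U (m + 1) = q y := by
      rw [h4, chi_of_mem hA hxA] at h2
      rw [h4, chi_of_mem hA hxA]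
      omega
    have hUx : U (m + 1) = ∑ i ∈ Finset.range (m + 1), chi A (T^[i] x) := by
      simp only [U]
      rw [← hxy, sum_backward_iterate]
    have hPx : P x (m + 1) := by
      refine ⟨?_, hxy.symm ▸ hy⟩
      have := hqn (m + 1) x
      rw [hxy, ← hUx, hU] at this
      simp only [N]
      linarith
    refine ⟨x, hxA, ?_⟩
    dsimp only
    rw [huniq (Nat.find_spec (hex x)) hPx, hxy]

end Comparison

/-! ### Homeomorphisms acting trivially on the dimension group, and the implications 1 → 3 → 2 -/

section Trivial

variable {X Y : Type*} [TopologicalSpace X] [TopologicalSpace Y]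

theorem eq_sum_chi {ι : Type*} {f : X → ι} (hf : IsLocallyConstant f) {s : Finset ι}
    (hs : ∀ x, f x ∈ s) (θ : ι → ℤ) {u : C(X, ℤ)} (hu : ∀ x, u x = θ (f x)) :
    u = ∑ i ∈ s, θ i • chi (f ⁻¹' {i}) := by
  classical
  ext x
  have h (i) : chi (f ⁻¹' {i}) x = if f x = i then 1 else 0 := chi_apply (hf.isClopen_fiber i) x
  simp only [ContinuousMap.coe_sum, Finset.sum_apply, ContinuousMap.coe_smul, Pi.smul_apply, h]
  simp [hu, hs]

theorem IsLocallyConstant.exists_finset [CompactSpace X] {ι : Type*} {f : X → ι}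
    (hf : IsLocallyConstant f) : ∃ s : Finset ι, ∀ x, f x ∈ s :=
  ⟨hf.range_finite.toFinset, fun x => by simp⟩

/-- Homeomorphisms acting trivially on the dimension group of `T`. -/
def trivialHomeos (T : X ≃ₜ X) : Subgroup (X ≃ₜ X) where
  carrier := {h | ∀ u : C(X, ℤ), u.comp (h : C(X, X)) - u ∈ cob T}
  one_mem' := by
    intro u
    have : u.comp ((1 : X ≃ₜ X) : C(X, X)) - u = 0 := by ext; simp
    rw [this]
    exact zero_mem _
  mul_mem' := by
    intro a b ha hb u
    have : u.comp ((a * b : X ≃ₜ X) : C(X, X)) - u =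
        ((u.comp (a : C(X, X))).comp (b : C(X, X)) - u.comp (a : C(X, X))) +
          (u.comp (a : C(X, X)) - u) := by ext; simp
    rw [this]
    exact add_mem (hb _) (ha _)
  inv_mem' := by
    intro a ha u
    have : u.comp ((a⁻¹ : X ≃ₜ X) : C(X, X)) - u =
        - ((u.comp ((a⁻¹ : X ≃ₜ X) : C(X, X))).comp (a : C(X, X)) -
          u.comp ((a⁻¹ : X ≃ₜ X) : C(X, X))) := by ext; simp
    rw [this]
    exact neg_mem (ha _)

theorem self_mem_trivialHomeos (T : X ≃ₜ X) : T ∈ trivialHomeos T := by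
  intro u
  rw [← neg_sub]
  exact neg_mem ⟨u, rfl⟩

/-- If `h` agrees with elements of `trivialHomeos T` on the pieces of a clopen partition, where
only the pieces met by the support of `u ∘ h` matter, then `u ∘ h - u` is a coboundary. -/
theorem comp_sub_mem_cob_of_pieces [CompactSpace X] {T : X ≃ₜ X} {ι : Type*} {j : X → ι}
    (hj : IsLocallyConstant j) {K : ι → X ≃ₜ X} (hK : ∀ i, K i ∈ trivialHomeos T) (h : X ≃ₜ X)
    (u : C(X, ℤ)) (hu : ∀ x, u (h x) ≠ 0 → h x = K (j x) x) :
    u.comp (h : C(X, X)) - u ∈ cob T := by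
  classical
  obtain ⟨s, hs⟩ := hj.exists_finset
  -- Cut `u` along the images under `h` of the pieces; in `v i ∘ h` the map `h` may be replaced by
  -- `K i`.
  let v : ι → C(X, ℤ) := fun i => chi ((j ∘ h.symm) ⁻¹' {i}) * u
  have hjh : IsLocallyConstant (j ∘ h.symm) := hj.comp_continuous h.symm.continuous
  have hv (i x) : v i x = if j (h.symm x) = i then u x else 0 := by
    have := chi_apply (hjh.isClopen_fiber i) x
    simp only [v, ContinuousMap.mul_apply]
    change chi {y | (j ∘ h.symm) y = i} x * _ = _
    rw [this]
    simp
  have h1 : u = ∑ i ∈ s, v i := by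
    ext x
    simp only [ContinuousMap.coe_sum, Finset.sum_apply, hv]
    simp [hs]
  have h2 : u.comp (h : C(X, X)) = ∑ i ∈ s, (v i).comp (K i : C(X, X)) := by
    ext x
    simp only [ContinuousMap.coe_sum, Finset.sum_apply, ContinuousMap.comp_apply, hv,
      ContinuousMap.coe_coe]
    have key (i) : (if j (h.symm (K i x)) = i then u (K i x) else 0) =
        if j x = i then u (h x) else 0 := by
      by_cases hx : j x = i ∧ u (h x) ≠ 0
      · obtain ⟨rfl, hx⟩ := hx
        rw [← hu x hx, h.symm_apply_apply]
      · have hr : (if j x = i then u (h x) else 0) = 0 := by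
          split_ifs with h3
          · by_contra h4; exact hx ⟨h3, h4⟩
          · rfl
        rw [hr]
        by_contra hcon
        obtain ⟨h5, h6⟩ : j (h.symm (K i x)) = i ∧ u (K i x) ≠ 0 := by
          by_cases h7 : j (h.symm (K i x)) = i
          · exact ⟨h7, by simpa [h7] using hcon⟩
          · simp [h7] at hcon
        -- `K i` might carry a point of another piece into the support of `v i`. The preimage under
        -- `h` of that value has the same image under `K i`, so injectivity of `K i` excludes this.
        have h8 := hu (h.symm (K i x)) (by rwa [h.apply_symm_apply])
        rw [h.apply_symm_apply, h5] at h8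
        have h9 := (K i).injective h8
        rw [← h9] at h5
        rw [h8, ← h9] at h6
        have h10 : h x = K i x := by
          conv_lhs => rw [h9]
          exact h.apply_symm_apply _
        exact hx ⟨h5, by rwa [h10]⟩
    rw [Finset.sum_congr rfl fun i _ => key i]
    simp [hs]
  rw [h2, h1]
  rw [← Finset.sum_sub_distrib]
  exact sum_mem fun i _ => hK i (v i)

theorem mem_trivialHomeos_of_pieces [CompactSpace X] {T : X ≃ₜ X} {ι : Type*} {j : X → ι}
    (hj : IsLocallyConstant j) {K : ι → X ≃ₜ X} (hK : ∀ i, K i ∈ trivialHomeos T) {h : X ≃ₜ X}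
    (hh : ∀ x, h x = K (j x) x) : h ∈ trivialHomeos T :=
  fun u => comp_sub_mem_cob_of_pieces hj hK h u fun x _ => hh x

/-- The homeomorphism of a strong speedup acts trivially on the dimension group. -/
theorem mem_trivialHomeos_of_speedup [IsCantorSpace X] {T R : X ≃ₜ X} {p : X → ℕ} (z : X)
    (hp : ∀ x, x ≠ z → ContinuousAt p x) (hR : ∀ x, R x = T^[p x] x) : R ∈ trivialHomeos T := by
  classical
  -- Adding a constant to `u` does not change `u ∘ R - u`. With `u (R z) = 0`, `u ∘ R` vanishes near
  -- `z`, so `p` set to `0` where `u ∘ R` vanishes is locally constant.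
  have key (u : C(X, ℤ)) (hu : u (R z) = 0) : u.comp (R : C(X, X)) - u ∈ cob T := by
    let p' : X → ℕ := fun x => if u (R x) = 0 then 0 else p x
    have huR : IsLocallyConstant fun x => u (R x) :=
      (IsLocallyConstant.iff_continuous _).2 (u.continuous.comp R.continuous)
    refine comp_sub_mem_cob_of_pieces (j := p') (K := fun n => T ^ n) ?_
      (fun n => pow_mem (self_mem_trivialHomeos T) n) R u fun x hx => ?_
    · rw [IsLocallyConstant.iff_eventually_eq]
      intro x
      filter_upwards [huR.eventually_eq x,
        show ∀ᶠ y in 𝓝 x, u (R x) ≠ 0 → p y = p x from by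
          by_cases h0 : u (R x) = 0
          · simp [h0]
          · have := hp x (by rintro rfl; exact h0 hu)
            filter_upwards [this (mem_nhds_discrete.2 (mem_singleton (p x)))] with y hy _
            exact hy] with y h1 h2
      simp only [p', h1]
      split_ifs with h3
      · rfl
      · exact h2 h3
    · simp only [p', hx, if_false]
      rw [homeo_pow_apply, hR]
  intro u
  have h1 := key (u - ContinuousMap.const X (u (R z))) (by simp)
  have h2 : (u - ContinuousMap.const X (u (R z))).comp (R : C(X, X)) -
      (u - ContinuousMap.const X (u (R z))) = u.comp (R : C(X, X)) - u := by
    ext; simp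
  rwa [h2] at h1

theorem IsStrongSpeedup.exists_homeo [IsCantorSpace X] {T : X ≃ₜ X} {S : Y ≃ₜ Y}
    (h : IsStrongSpeedup S T) :
    ∃ h : X ≃ₜ Y, ∀ f : C(Y, ℤ), f ∈ cob S → f.comp (h : C(X, Y)) ∈ cob T := by
  obtain ⟨p, -, hp, h, hconj⟩ := h
  obtain ⟨z, hz⟩ : ∃ z, ∀ x, x ≠ z → ContinuousAt p x := by
    by_cases hc : ∃ z, ¬ ContinuousAt p z
    · obtain ⟨z, hz⟩ := hc
      exact ⟨z, fun x hx => by_contra fun hx' => hx (hp hx' hz)⟩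
    · push Not at hc
      obtain ⟨z⟩ : Nonempty X := inferInstance
      exact ⟨z, fun x _ => hc x⟩
  have hR := mem_trivialHomeos_of_speedup (T := T) (R := (h.trans S).trans h.symm) z hz (fun x => by
    simp [← hconj])
  refine ⟨h, ?_⟩
  rintro _ ⟨f, rfl⟩
  have := neg_mem (hR (f.comp (h : C(X, Y))))
  convert this using 1
  ext x
  simp

/-- Composition with `h` induces `φ`. Interpolation in `X` gives a representative between `0` and `f
∘ h`, which `h.symm` carries back below `f`; both inequalities stay strict because `φ` maps `0` to
`0`. -/
theorem exists_exhaustive_of_homeo [CompactSpace X] {T : X ≃ₜ X} {S : Y ≃ₜ Y}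
    (hT : IsMinimalHomeo T) (h : X ≃ₜ Y)
    (hh : ∀ f : C(Y, ℤ), f ∈ cob S → f.comp (h : C(X, Y)) ∈ cob T) :
    ∃ φ : DimGroup S →+ DimGroup T,
      IsUnitalEpi (posCone S) (distUnit S) (posCone T) (distUnit T) φ ∧
        IsExhaustive (posCone S) (posCone T) φ := by
  let φ₀ : C(Y, ℤ) →+ C(X, ℤ) :=
    { toFun := fun f => f.comp (h : C(X, Y))
      map_zero' := by ext; simp
      map_add' := by intro f g; ext; simp }
  let φ : DimGroup S →+ DimGroup T := QuotientAddGroup.map (cob S) (cob T) φ₀ hh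
  have hφ (f : C(Y, ℤ)) : φ (QuotientAddGroup.mk f) =
      QuotientAddGroup.mk (f.comp (h : C(X, Y))) := rfl
  have hback (f : C(X, ℤ)) :
      φ (QuotientAddGroup.mk (f.comp (h.symm : C(Y, X)))) = QuotientAddGroup.mk f := by
    rw [hφ]
    congr 1
    ext; simp
  refine ⟨φ, ⟨?_, ?_, ?_⟩, ?_⟩
  · intro a
    obtain ⟨f, rfl⟩ := QuotientAddGroup.mk_surjective a
    exact ⟨_, hback f⟩
  · rintro _ ⟨_, ⟨f, hf, rfl⟩, rfl⟩
    exact ⟨f.comp (h : C(X, Y)), fun x => hf (h x), rfl⟩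
  · rfl
  · rintro _ ⟨f, hf, rfl⟩ a ha haf
    rw [hφ] at haf
    obtain ⟨k, rfl, hk⟩ := hT.exists_mk_eq_and_le (fun x => hf (h x))
      (by simpa using ha.1) haf
    refine ⟨_, hback k, ⟨⟨k.comp (h.symm : C(Y, X)), fun y => (hk _).1, by simp⟩, ?_⟩,
      ⟨⟨f - k.comp (h.symm : C(Y, X)), fun y => ?_, by simp⟩, ?_⟩⟩
    · intro h0
      apply ha.2
      have := congrArg φ (show _ = _ from h0)
      rw [map_sub, hback, map_zero] at this
      exact this
    · have := (hk (h.symm y)).2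
      simpa using this
    · intro h0
      apply haf.2
      have := congrArg φ (show _ = _ from h0)
      rw [map_sub, hback, hφ, map_zero] at this
      exact this

end Trivial

/-! ### Homeomorphisms from codes, and realizing classes by clopen sets -/

section Codes

variable {X Y : Type*} [TopologicalSpace X] [TopologicalSpace Y]

theorem exists_forall_code_eq {X : Type*} [CompactSpace Y] {f : ℕ → X → ℕ} {g : ℕ → Y → ℕ}
    (hg : ∀ n, IsLocallyConstant (g n)) (hr : ∀ n, range (f n) ⊆ range (g n))
    (hc : ∀ n x y, f (n + 1) x = g (n + 1) y → f n x = g n y) (x : X) :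
    ∃ y, ∀ n, g n y = f n x := by
  obtain ⟨y, hy⟩ := IsCompact.nonempty_iInter_of_sequence_nonempty_isCompact_isClosed
    (fun n => {y | g n y = f n x}) (fun n y hy => (hc n x y hy.symm).symm)
    (fun n => hr n ⟨x, rfl⟩) ((hg 0).isClosed_fiber _).isCompact
    fun n => (hg n).isClosed_fiber _
  exact ⟨y, fun n => mem_iInter.1 hy n⟩

/-- Two compact spaces with compatible separating sequences of finite codes with the same values
are homeomorphic. -/
theorem exists_homeo_of_codes [CompactSpace X] [CompactSpace Y] [T2Space Y]
    {f : ℕ → X → ℕ} {g : ℕ → Y → ℕ}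
    (hf : ∀ n, IsLocallyConstant (f n)) (hg : ∀ n, IsLocallyConstant (g n))
    (hr : ∀ n, range (f n) = range (g n))
    (hc : ∀ n x y, f (n + 1) x = g (n + 1) y → f n x = g n y)
    (hfs : ∀ x x', (∀ n, f n x = f n x') → x = x')
    (hgs : ∀ y y', (∀ n, g n y = g n y') → y = y') :
    ∃ h : X ≃ₜ Y, ∀ n x, g n (h x) = f n x := by
  choose h hh using exists_forall_code_eq hg (fun n => (hr n).subset) hc
  choose k hk using exists_forall_code_eq hf (fun n => (hr n).superset)
    fun n y x he => (hc n x y he.symm).symm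
  have hcont : Continuous h := by
    have hG : IsClosedEmbedding fun y n => g n y :=
      Continuous.isClosedEmbedding (continuous_pi fun n => (hg n).continuous)
        fun y y' he => hgs y y' (congrFun he)
    rw [hG.isInducing.continuous_iff]
    refine continuous_pi fun n => ?_
    simp only [Function.comp_apply, hh]
    exact (hf n).continuous
  let e : X ≃ Y :=
    { toFun := h
      invFun := k
      left_inv := fun x => hfs _ _ fun n => by rw [hk, hh]
      right_inv := fun y => hgs _ _ fun n => by rw [hh, hk] }
  exact ⟨Continuous.homeoOfEquivCompactToT2 (f := e) hcont, fun n x => hh x n⟩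

theorem cl_image_of_mem_trivialHomeos {T R : X ≃ₜ X} (hR : R ∈ trivialHomeos T) {W : Set X}
    (hW : IsClopen W) : cl T (R '' W) = cl T W := by
  have h := hR (chi (R '' W))
  have hRW : IsClopen (R '' W) := ⟨R.isClosed_image.2 hW.isClosed, R.isOpen_image.2 hW.isOpen⟩
  have h1 : (chi (R '' W)).comp (R : C(X, X)) = chi W := by
    ext x
    simp only [ContinuousMap.comp_apply, ContinuousMap.coe_coe]
    by_cases hx : x ∈ W
    · rw [chi_of_mem hW hx, chi_of_mem hRW (mem_image_of_mem R hx)]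
    · rw [chi_of_notMem hW hx, chi_of_notMem hRW (by rwa [R.injective.mem_set_image])]
  rw [h1] at h
  exact (QuotientAddGroup.eq_iff_sub_mem.2 h).symm

/-- A nonempty clopen subset can be exchanged for an equivalent one containing a given point. -/
theorem IsMinimalHomeo.exists_cl_eq_mem [IsCantorSpace X] {T : X ≃ₜ X} (hT : IsMinimalHomeo T)
    {U A : Set X} (hU : IsClopen U) (hA : IsClopen A) (hAU : A ⊆ U) (hne : A.Nonempty) {x : X}
    (hx : x ∈ U) : ∃ A', IsClopen A' ∧ A' ⊆ U ∧ cl T A' = cl T A ∧ x ∈ A' := by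
  by_cases hxA : x ∈ A
  · exact ⟨A, hA, hAU, rfl, hxA⟩
  obtain ⟨N, hN⟩ := hT.exists_forall_visit hA.isOpen hne
  obtain ⟨i, -, hi⟩ := hN x
  rw [← homeo_pow_apply] at hi
  obtain ⟨W, hW, hxW, hWs⟩ := IsCantorSpace.exists_isClopen_subset
    ((hU.diff hA).inter (hA.preimage (T ^ i : X ≃ₜ X).continuous)).isOpen ⟨⟨hx, hxA⟩, hi⟩
  have hR : (T ^ i : X ≃ₜ X) ∈ trivialHomeos T := pow_mem (self_mem_trivialHomeos T) i
  have hRW : IsClopen ((T ^ i : X ≃ₜ X) '' W) := 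
    ⟨(T ^ i : X ≃ₜ X).isClosed_image.2 hW.isClosed, (T ^ i : X ≃ₜ X).isOpen_image.2 hW.isOpen⟩
  have hsub : (T ^ i : X ≃ₜ X) '' W ⊆ A := image_subset_iff.2 fun y hy => (hWs hy).2
  refine ⟨(A \ (T ^ i : X ≃ₜ X) '' W) ∪ W, (hA.diff hRW).union hW,
    union_subset (sdiff_subset.trans hAU) fun y hy => (hWs hy).1.1, ?_, Or.inr hxW⟩
  rw [cl_union T (hA.diff hRW) hW, cl_diff T hA hRW, inter_eq_right.2 hsub,
    cl_image_of_mem_trivialHomeos hR hW, sub_add_cancel]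
  rw [Set.disjoint_left]
  exact fun y hy hyW => (hWs hyW).1.2 hy.1

/-- An integer function between `0` and `chi U` is an indicator, so interpolation realizes the class
by some `A ⊆ U`. Strictness on both sides makes `A` and `U \ A` nonempty, so either can be exchanged
for an equivalent set containing the prescribed point. -/
theorem IsMinimalHomeo.exists_cl_eq_subset [IsCantorSpace X] {T : X ≃ₜ X} (hT : IsMinimalHomeo T)
    {U : Set X} (hU : IsClopen U) {a : DimGroup T} (ha : ConeLT (posCone T) 0 a)
    (haU : ConeLT (posCone T) a (cl T U)) {s : Set X} (hs : s.Subsingleton) (hsU : s ⊆ U)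
    (P : Prop) : ∃ A, IsClopen A ∧ A ⊆ U ∧ cl T A = a ∧ ∀ x ∈ s, (x ∈ A ↔ P) := by
  obtain ⟨k, hk, hkU⟩ := hT.exists_mk_eq_and_le (chi_nonneg U) (by simpa using ha.1) haU
  let A : Set X := k ⁻¹' {1}
  have hA : IsClopen A := (isClopen_discrete _).preimage k.continuous
  have hAU : A ⊆ U := by
    intro x hx
    by_contra hxU
    have h1 := (hkU x).2
    rw [chi_of_notMem hU hxU] at h1
    have h2 : k x = 1 := hx
    omega
  have hchi : chi A = k := by
    ext x
    have h1 := hkU x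
    have h2 : chi U x ≤ 1 := by
      rw [chi_apply hU]; split_ifs <;> simp
    by_cases hx : x ∈ A
    · rw [chi_of_mem hA hx]
      exact (show k x = 1 from hx).symm
    · have h3 : k x ≠ 1 := hx
      rw [chi_of_notMem hA hx]
      omega
  have hcl : cl T A = a := by rw [cl, hchi, hk]
  have hAne : A.Nonempty := by
    rw [nonempty_iff_ne_empty]
    intro h0
    rw [h0, cl_empty] at hcl
    exact ha.2 (by simp [← hcl])
  have hdiff : cl T (U \ A) = cl T U - a := by
    rw [cl_diff T hU hA, inter_eq_right.2 hAU, hcl]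
  have hUAne : (U \ A).Nonempty := by
    rw [nonempty_iff_ne_empty]
    intro h0
    rw [h0, cl_empty] at hdiff
    exact haU.2 hdiff.symm
  rcases hs.eq_empty_or_singleton with rfl | ⟨x, rfl⟩
  · exact ⟨A, hA, hAU, hcl, by simp⟩
  have hxU : x ∈ U := hsU rfl
  by_cases hP : P
  · obtain ⟨A', h1, h2, h3, h4⟩ := hT.exists_cl_eq_mem hU hA hAU hAne hxU
    exact ⟨A', h1, h2, h3.trans hcl, by simp [h4, hP]⟩
  · obtain ⟨A', h1, h2, h3, h4⟩ := hT.exists_cl_eq_mem hU (hU.diff hA) sdiff_subset hUAne hxU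
    refine ⟨U \ A', hU.diff h1, sdiff_subset, ?_, by simp [h4, hP]⟩
    rw [cl_diff T hU h1, inter_eq_right.2 h2, h3, hdiff, sub_sub_cancel]

/-- A relation between ordered groups along which elements below a given one can be lifted. -/
structure IsTransfer {G H : Type*} [AddCommGroup G] [AddCommGroup H] (P : Set G) (Q : Set H)
    (r : G → H → Prop) : Prop where
  zero : r 0 0
  sub : ∀ {a a' b b'}, r a b → r a' b' → r (a - a') (b - b')
  exists_between : ∀ {a b}, a ∈ P → b ∈ Q → r a b → ∀ {b'}, ConeLT Q 0 b' → ConeLT Q b' b →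
    ∃ a', r a' b' ∧ ConeLT P 0 a' ∧ ConeLT P a' a

/-- One half-step of the back-and-forth. In each level set of `g` the trace of `B` is empty,
everything, or strictly in between; only the last case needs a lift of the class. Injectivity of `f
∘ a` leaves at most one tracked point per level set. -/
theorem IsTransfer.exists_clopen [IsCantorSpace X] [CompactSpace Y] {T : X ≃ₜ X} {S : Y ≃ₜ Y}
    (hT : IsMinimalHomeo T) (hS : IsMinimalHomeo S) {r : DimGroup T → DimGroup S → Prop}
    (hr : IsTransfer (posCone T) (posCone S) r) {f : X → ℕ} {g : Y → ℕ}
    (hf : IsLocallyConstant f) (hg : IsLocallyConstant g)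
    (hfg : ∀ n, r (cl T (f ⁻¹' {n})) (cl S (g ⁻¹' {n}))) {ι : Type*} {a : ι → X} {b : ι → Y}
    (hab : ∀ i, f (a i) = g (b i)) (hinj : Function.Injective (f ∘ a)) {B : Set Y}
    (hB : IsClopen B) : ∃ A : Set X, IsClopen A ∧
      (∀ n, r (cl T (f ⁻¹' {n} ∩ A)) (cl S (g ⁻¹' {n} ∩ B))) ∧ ∀ i, a i ∈ A ↔ b i ∈ B := by
  have key (n : ℕ) : ∃ A : Set X, IsClopen A ∧ A ⊆ f ⁻¹' {n} ∧
      r (cl T A) (cl S (g ⁻¹' {n} ∩ B)) ∧ ∀ i, f (a i) = n → (a i ∈ A ↔ b i ∈ B) := by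
    have hU : IsClopen (f ⁻¹' {n}) := hf.isClopen_fiber n
    have hV : IsClopen (g ⁻¹' {n}) := hg.isClopen_fiber n
    rcases (g ⁻¹' {n} ∩ B).eq_empty_or_nonempty with h0 | h0
    · refine ⟨∅, isClopen_empty, empty_subset _, by rw [h0, cl_empty, cl_empty]; exact hr.zero, ?_⟩
      intro i hi
      simp only [mem_empty_iff_false, false_iff]
      intro hb
      exact (h0 ▸ (⟨(hab i).symm.trans hi, hb⟩ : b i ∈ g ⁻¹' {n} ∩ B) : b i ∈ (∅ : Set Y))
    rcases (g ⁻¹' {n} \ B).eq_empty_or_nonempty with h1 | h1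
    · have h2 : g ⁻¹' {n} ⊆ B := sdiff_eq_empty.1 h1
      refine ⟨f ⁻¹' {n}, hU, Subset.rfl, by rw [inter_eq_left.2 h2]; exact hfg n, ?_⟩
      intro i hi
      exact ⟨fun _ => h2 ((hab i).symm.trans hi), fun _ => hi⟩
    obtain ⟨α, hα, hα0, hαU⟩ := hr.exists_between (cl_mem_posCone T _) (cl_mem_posCone S _) (hfg n)
      (b' := cl S (g ⁻¹' {n} ∩ B))
      ⟨by rw [sub_zero]; exact cl_mem_posCone S _, by
        rw [sub_zero]; exact hS.cl_ne_zero (hV.inter hB) h0⟩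
      (by rw [ConeLT, ← cl_diff S hV hB]
          exact ⟨cl_mem_posCone S _, hS.cl_ne_zero (hV.diff hB) h1⟩)
    have hs : {x | ∃ i, f (a i) = n ∧ x = a i}.Subsingleton := by
      rintro _ ⟨i, hi, rfl⟩ _ ⟨j, hj, rfl⟩
      rw [hinj (hi.trans hj.symm)]
    obtain ⟨A, hA, hAU, hAα, hAs⟩ := hT.exists_cl_eq_subset hU hα0 hαU hs
      (by rintro _ ⟨i, hi, rfl⟩; exact hi) (∃ i, f (a i) = n ∧ b i ∈ B)
    refine ⟨A, hA, hAU, hAα ▸ hα, fun i hi => ?_⟩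
    rw [hAs (a i) ⟨i, hi, rfl⟩]
    constructor
    · rintro ⟨j, hj, hb⟩
      rwa [hinj (hi.trans hj.symm)]
    · exact fun hb => ⟨i, hi, hb⟩
  choose A hA hAU hAr hAi using key
  have hinter (n) : f ⁻¹' {n} ∩ {x | x ∈ A (f x)} = A n := by
    ext x
    constructor
    · rintro ⟨rfl, hx⟩; exact hx
    · intro hx
      have h1 : f x = n := hAU n hx
      exact ⟨h1, by simpa [h1] using hx⟩
  have hopen (C : ℕ → Set X) (hC : ∀ n, IsOpen (C n)) : IsOpen {x | x ∈ C (f x)} := by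
    rw [isOpen_iff_mem_nhds]
    intro x hx
    filter_upwards [hf.eventually_eq x, (hC (f x)).mem_nhds hx] with y hy hyC
    simpa [hy] using hyC
  refine ⟨{x | x ∈ A (f x)}, ⟨⟨hopen (fun n => (A n)ᶜ) fun n => (hA n).compl.isOpen⟩,
    hopen A fun n => (hA n).isOpen⟩, fun n => ?_, fun i => hAi _ i rfl⟩
  rw [hinter]
  exact hAr n

end Codes

/-! ### The back-and-forth construction, and the implication 2 → 3 -/

section BackAndForth

variable {X Y : Type*} [TopologicalSpace X] [TopologicalSpace Y]

open Classical in
/-- Refine a code by a set. -/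
noncomputable def refineCode (f : X → ℕ) (A : Set X) (x : X) : ℕ :=
  2 * f x + if x ∈ A then 1 else 0

theorem refineCode_eq_iff {X Y : Type*} {f : X → ℕ} {g : Y → ℕ} {A : Set X} {B : Set Y} {x : X}
    {y : Y} : refineCode f A x = refineCode g B y ↔ f x = g y ∧ (x ∈ A ↔ y ∈ B) := by
  unfold refineCode
  by_cases h1 : x ∈ A <;> by_cases h2 : y ∈ B <;> simp [h1, h2] <;> omega

theorem isLocallyConstant_refineCode {f : X → ℕ} {A : Set X} (hf : IsLocallyConstant f)
    (hA : IsClopen A) : IsLocallyConstant (refineCode f A) := by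
  classical
  rw [IsLocallyConstant.iff_eventually_eq]
  intro x
  have h1 : ∀ᶠ y in 𝓝 x, (y ∈ A ↔ x ∈ A) := by
    by_cases hx : x ∈ A
    · filter_upwards [hA.isOpen.mem_nhds hx] with y hy
      simp [hx, hy]
    · filter_upwards [hA.compl.isOpen.mem_nhds hx] with y hy
      simpa [hx] using hy
  filter_upwards [hf.eventually_eq x, h1] with y hy hyA
  exact refineCode_eq_iff.2 ⟨hy, hyA⟩

theorem refineCode_preimage_odd {X : Type*} (f : X → ℕ) (A : Set X) (n : ℕ) :
    refineCode f A ⁻¹' {2 * n + 1} = f ⁻¹' {n} ∩ A := by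
  ext x
  by_cases h : x ∈ A <;> simp [refineCode, h]
  omega

theorem refineCode_preimage_even {X : Type*} (f : X → ℕ) (A : Set X) (n : ℕ) :
    refineCode f A ⁻¹' {2 * n} = f ⁻¹' {n} \ A := by
  ext x
  by_cases h : x ∈ A <;> simp [refineCode, h]
  omega

/-- Two codes whose level sets have related classes and which agree at tracked points. -/
structure MatchedCodes (T : X ≃ₜ X) (S : Y ≃ₜ Y) (r : DimGroup T → DimGroup S → Prop)
    {ι : Type*} (a : ι → X) (b : ι → Y) (f : X → ℕ) (g : Y → ℕ) : Prop where
  left : IsLocallyConstant f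
  right : IsLocallyConstant g
  rel : ∀ n, r (cl T (f ⁻¹' {n})) (cl S (g ⁻¹' {n}))
  eq : ∀ i, f (a i) = g (b i)
  inj : Function.Injective (f ∘ a)

theorem MatchedCodes.swap {T : X ≃ₜ X} {S : Y ≃ₜ Y} {r : DimGroup T → DimGroup S → Prop}
    {ι : Type*} {a : ι → X} {b : ι → Y} {f : X → ℕ} {g : Y → ℕ}
    (h : MatchedCodes T S r a b f g) : MatchedCodes S T (fun x y => r y x) b a g f :=
  ⟨h.right, h.left, h.rel, fun i => (h.eq i).symm, by
    have : g ∘ b = f ∘ a := funext fun i => (h.eq i).symm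
    rw [this]; exact h.inj⟩

theorem MatchedCodes.refine [IsCantorSpace X] [CompactSpace Y] {T : X ≃ₜ X} {S : Y ≃ₜ Y}
    (hT : IsMinimalHomeo T) (hS : IsMinimalHomeo S) {r : DimGroup T → DimGroup S → Prop}
    (hr : IsTransfer (posCone T) (posCone S) r) {ι : Type*} {a : ι → X} {b : ι → Y}
    {f : X → ℕ} {g : Y → ℕ} (h : MatchedCodes T S r a b f g) {B : Set Y} (hB : IsClopen B) :
    ∃ A, MatchedCodes T S r a b (refineCode f A) (refineCode g B) := by
  obtain ⟨A, hA, hAr, hAi⟩ := hr.exists_clopen hT hS h.left h.right h.rel h.eq h.inj hB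
  refine ⟨A, isLocallyConstant_refineCode h.left hA, isLocallyConstant_refineCode h.right hB,
    fun n => ?_, fun i => refineCode_eq_iff.2 ⟨h.eq i, hAi i⟩, fun i j hij => h.inj ?_⟩
  · obtain ⟨m, rfl | rfl⟩ := n.even_or_odd'
    · rw [refineCode_preimage_even, refineCode_preimage_even,
        cl_diff T (U := f ⁻¹' {m}) (h.left.isClopen_fiber _) hA,
        cl_diff S (U := g ⁻¹' {m}) (h.right.isClopen_fiber _) hB]
      exact hr.sub (h.rel m) (hAr m)
    · rw [refineCode_preimage_odd, refineCode_preimage_odd]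
      exact hAr m
  · exact (refineCode_eq_iff.1 hij).1

theorem mk_comp_eq_of_preimage {T : X ≃ₜ X} {S : Y ≃ₜ Y} [CompactSpace X] [CompactSpace Y]
    (φ : DimGroup S →+ DimGroup T) {ι : Type*} {f : X → ι} {g : Y → ι} (hf : IsLocallyConstant f)
    (hg : IsLocallyConstant g) (h : ∀ i, φ (cl S (g ⁻¹' {i})) = cl T (f ⁻¹' {i})) (θ : ι → ℤ)
    {u : C(Y, ℤ)} {v : C(X, ℤ)} (hu : ∀ y, u y = θ (g y)) (hv : ∀ x, v x = θ (f x)) :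
    φ (QuotientAddGroup.mk u) = QuotientAddGroup.mk v := by
  classical
  obtain ⟨s, hs⟩ := hf.exists_finset
  obtain ⟨t, ht⟩ := hg.exists_finset
  rw [eq_sum_chi hg (s := s ∪ t) (fun y => by simp [ht]) θ hu,
    eq_sum_chi hf (s := s ∪ t) (fun y => by simp [hs]) θ hv]
  rw [← QuotientAddGroup.mk'_apply, ← QuotientAddGroup.mk'_apply, map_sum, map_sum, map_sum]
  refine Finset.sum_congr rfl fun i _ => ?_
  rw [map_zsmul, map_zsmul, map_zsmul]
  exact congrArg _ (h i)

/-- A homomorphism of dimension groups that is strictly positive and exhaustive is induced by a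
homeomorphism, which may be chosen to respect given matched codes and tracked points. -/
theorem exists_homeo_of_matchedCodes [IsCantorSpace X] [IsCantorSpace Y] {T : X ≃ₜ X} {S : Y ≃ₜ Y}
    (hT : IsMinimalHomeo T) (hS : IsMinimalHomeo S) {φ : DimGroup S →+ DimGroup T}
    (hpos : ∀ b, ConeLT (posCone S) 0 b → ConeLT (posCone T) 0 (φ b))
    (hex : IsExhaustive (posCone S) (posCone T) φ) {ι : Type*} {a : ι → X} {b : ι → Y}
    {f₀ : X → ℕ} {g₀ : Y → ℕ} (h₀ : MatchedCodes T S (fun x y => φ y = x) a b f₀ g₀) :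
    ∃ h : X ≃ₜ Y, (∀ u : C(Y, ℤ), QuotientAddGroup.mk (u.comp (h : C(X, Y))) =
      φ (QuotientAddGroup.mk u)) ∧ (∀ x, g₀ (h x) = f₀ x) ∧ ∀ i, h (a i) = b i := by
  classical
  -- Clopen sets of `Y` are matched in `X` by applying `φ`, which preserves strict inequalities.
  have hr : IsTransfer (posCone T) (posCone S) fun x y => φ y = x := by
    refine ⟨map_zero φ, ?_, ?_⟩
    · rintro _ _ b b' rfl rfl
      exact map_sub φ b b'
    · rintro _ b - hb rfl b' h0 hlt
      refine ⟨_, rfl, hpos _ h0, ?_⟩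
      have := hpos (b - b') (by simpa [ConeLT] using hlt)
      simpa [ConeLT] using this
  -- The opposite direction is exactly exhaustiveness.
  have hr' : IsTransfer (posCone S) (posCone T) fun y x => φ y = x := by
    refine ⟨map_zero φ, ?_, ?_⟩
    · rintro b b' _ _ rfl rfl
      exact map_sub φ b b'
    · rintro b _ hb - rfl a' h0 hlt
      exact hex b hb a' h0 hlt
  obtain ⟨eX, heX⟩ := exists_surjective_nat (TopologicalSpace.Clopens X)
  obtain ⟨eY, heY⟩ := exists_surjective_nat (TopologicalSpace.Clopens Y)
  let St := {p : (X → ℕ) × (Y → ℕ) // MatchedCodes T S (fun x y => φ y = x) a b p.1 p.2}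
  have step (n : ℕ) (p : St) : ∃ p' : St,
      (∀ x y, p'.1.1 x = p'.1.2 y → p.1.1 x = p.1.2 y) ∧
      (∀ x x', p'.1.1 x = p'.1.1 x' → (x ∈ eX n ↔ x' ∈ eX n)) ∧
      (∀ y y', p'.1.2 y = p'.1.2 y' → (y ∈ eY n ↔ y' ∈ eY n)) := by
    obtain ⟨A, hA⟩ := p.2.refine hT hS hr (eY n).isClopen
    obtain ⟨B, hB⟩ := hA.swap.refine hS hT hr' (eX n).isClopen
    refine ⟨⟨(_, _), hB.swap⟩, fun x y h => ?_, fun x x' h => ?_, fun y y' h => ?_⟩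
    · exact (refineCode_eq_iff.1 (refineCode_eq_iff.1 h).1).1
    · exact (refineCode_eq_iff.1 h).2
    · exact (refineCode_eq_iff.1 (refineCode_eq_iff.1 h).1).2
  choose F hF1 hF2 hF3 using step
  let s : ℕ → St := fun n => Nat.rec ⟨(f₀, g₀), h₀⟩ (fun n p => F n p) n
  -- Only the empty clopen set has class `0`, and `φ` kills no nonzero positive class, so matched
  -- level sets are empty simultaneously.
  have hiff (n m) : m ∈ range (s n).1.1 ↔ m ∈ range (s n).1.2 := by
    have hX := (s n).2.left.isClopen_fiber m
    have hY := (s n).2.right.isClopen_fiber m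
    have hm := (s n).2.rel m
    rw [← preimage_singleton_nonempty, ← preimage_singleton_nonempty]
    constructor
    · intro hne
      rw [nonempty_iff_ne_empty]
      intro h0
      rw [h0, cl_empty, map_zero] at hm
      exact hT.cl_ne_zero hX hne hm.symm
    · intro hne
      rw [nonempty_iff_ne_empty]
      intro h0
      rw [h0, cl_empty] at hm
      have := hpos (cl S ((s n).1.2 ⁻¹' {m})) ⟨by
        rw [sub_zero]; exact cl_mem_posCone S _, by rw [sub_zero]; exact hS.cl_ne_zero hY hne⟩
      rw [hm] at this
      exact this.2 (by simp)
  obtain ⟨h, hh⟩ := exists_homeo_of_codes (f := fun n => (s n).1.1) (g := fun n => (s n).1.2)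
    (fun n => (s n).2.left) (fun n => (s n).2.right) (fun n => Set.ext (hiff n))
    (fun n x y hxy => hF1 n (s n) x y hxy)
    (fun x x' hx => by
      by_contra hne
      obtain ⟨V, hV, h1, h2⟩ := IsCantorSpace.exists_isClopen_separating hne
      obtain ⟨n, hn⟩ := heX ⟨V, hV⟩
      have := hF2 n (s n) x x' (hx (n + 1))
      rw [hn] at this
      exact h2 (this.1 h1))
    (fun x x' hx => by
      by_contra hne
      obtain ⟨V, hV, h1, h2⟩ := IsCantorSpace.exists_isClopen_separating hne
      obtain ⟨n, hn⟩ := heY ⟨V, hV⟩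
      have := hF3 n (s n) x x' (hx (n + 1))
      rw [hn] at this
      exact h2 (this.1 h1))
  refine ⟨h, ?_, fun x => hh 0 x, fun i => ?_⟩
  · have hchi {V : Set Y} (hV : IsClopen V) :
        φ (cl S V) = QuotientAddGroup.mk ((chi V).comp (h : C(X, Y))) := by
      obtain ⟨n, hn⟩ := heY ⟨V, hV⟩
      have hres (y y') (hy : (s (n + 1)).1.2 y = (s (n + 1)).1.2 y') : y ∈ V ↔ y' ∈ V := by
        have := hF3 n (s n) y y' hy
        rwa [hn] at this
      let θ : ℕ → ℤ := fun m => if ∃ y ∈ V, (s (n + 1)).1.2 y = m then 1 else 0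
      have hθ (y) : chi V y = θ ((s (n + 1)).1.2 y) := by
        rw [chi_apply hV]
        refine if_congr ⟨fun hy => ⟨y, hy, rfl⟩, ?_⟩ rfl rfl
        rintro ⟨y', hy', he⟩
        exact (hres _ _ he).1 hy'
      refine mk_comp_eq_of_preimage φ (s (n + 1)).2.left (s (n + 1)).2.right (s (n + 1)).2.rel θ
        hθ fun x => (hθ (h x)).trans (congrArg θ (hh (n + 1) x))
    intro u
    have hu : IsLocallyConstant u := (IsLocallyConstant.iff_continuous _).2 u.continuous
    have huh : IsLocallyConstant (u ∘ h) := hu.comp_continuous h.continuous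
    refine (mk_comp_eq_of_preimage φ huh hu (fun i => ?_) id (fun _ => rfl) fun _ => rfl).symm
    rw [hchi (V := u ⁻¹' {i}) (hu.isClopen_fiber i), cl]
    congr 1
    ext x
    have h1 : (chi ({y | u y = i})) (h x) = _ := chi_apply (hu.isClopen_fiber i) (h x)
    have h2 : (chi (u ∘ h ⁻¹' {i})) x = _ := chi_apply (huh.isClopen_fiber i) x
    rw [h2]
    exact h1
  · by_contra hne
    obtain ⟨V, hV, h1, h2⟩ := IsCantorSpace.exists_isClopen_separating hne
    obtain ⟨n, hn⟩ := heY ⟨V, hV⟩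
    have h3 : (s (n + 1)).1.2 (h (a i)) = (s (n + 1)).1.2 (b i) :=
      (hh (n + 1) _).trans ((s (n + 1)).2.eq i)
    have := hF3 n (s n) _ _ h3
    rw [hn] at this
    exact h2 (this.1 h1)

/-- Unital positive homomorphisms between dimension groups are strictly positive. -/
theorem IsUnitalEpi.coneLT_map [CompactSpace X] [Nonempty X] [CompactSpace Y] {T : X ≃ₜ X}
    {S : Y ≃ₜ Y} (hT : IsMinimalHomeo T) (hS : IsMinimalHomeo S) {φ : DimGroup S →+ DimGroup T}
    (hφ : IsUnitalEpi (posCone S) (distUnit S) (posCone T) (distUnit T) φ) (b : DimGroup S)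
    (hb : ConeLT (posCone S) 0 b) : ConeLT (posCone T) 0 (φ b) := by
  rw [ConeLT, sub_zero] at hb ⊢
  refine ⟨hφ.map_cone ⟨b, hb.1, rfl⟩, fun h0 => ?_⟩
  have h0 : φ b = 0 := h0
  obtain ⟨⟨f, hf, rfl⟩, hne⟩ := hb
  have hf0 : f ≠ 0 := by
    rintro rfl
    exact hne (by simp)
  obtain ⟨M, hM⟩ := hS.exists_le_sum hf hf0 1
  -- `F ≥ 1` has class `M • [f]`. If `φ [f] = 0`, then `F - 1 ≥ 0` makes `-[1]` positive in the
  -- target, which is impossible.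
  let F : C(Y, ℤ) := ∑ i ∈ Finset.range M, f.comp ((S ^ i : Y ≃ₜ Y) : C(Y, Y))
  have hF (y) : 1 ≤ F y := by
    have := hM M le_rfl y
    simpa [F, ContinuousMap.sum_apply, homeo_pow_apply] using this
  have hFf : (QuotientAddGroup.mk F : DimGroup S) = M • QuotientAddGroup.mk f := by
    rw [← QuotientAddGroup.mk'_apply, map_sum]
    rw [Finset.sum_congr rfl (g := fun _ => QuotientAddGroup.mk f), Finset.sum_const,
      Finset.card_range]
    intro i _
    exact QuotientAddGroup.eq_iff_sub_mem.2 (pow_mem (self_mem_trivialHomeos S) i f)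
  have h1 : φ (QuotientAddGroup.mk (F - 1)) ∈ posCone T :=
    hφ.map_cone ⟨_, ⟨F - 1, fun y => by simpa using hF y, rfl⟩, rfl⟩
  have h2 : φ (QuotientAddGroup.mk (F - 1)) = - distUnit T := by
    rw [QuotientAddGroup.mk_sub, map_sub, hFf, map_nsmul, h0, smul_zero, zero_sub]
    exact congrArg _ hφ.map_unit
  obtain ⟨q, hq, hq'⟩ := h1
  rw [h2] at hq'
  have h3 : q + 1 = 0 := by
    refine hT.eq_zero_of_mk_eq_zero (fun x => ?_) ?_
    · simpa using (hq x).trans (by simp)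
    · rw [QuotientAddGroup.mk_add, hq', distUnit]
      simp
  obtain ⟨x⟩ : Nonempty X := inferInstance
  have h4 := DFunLike.congr_fun h3 x
  have h5 := hq x
  simp at h4
  omega

/-- With no tracked points the back-and-forth can start from constant codes; these match because `φ`
preserves the unit. -/
theorem exists_homeo_of_exhaustive [IsCantorSpace X] [IsCantorSpace Y] {T : X ≃ₜ X} {S : Y ≃ₜ Y}
    (hT : IsMinimalHomeo T) (hS : IsMinimalHomeo S) {φ : DimGroup S →+ DimGroup T}
    (hφ : IsUnitalEpi (posCone S) (distUnit S) (posCone T) (distUnit T) φ)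
    (hex : IsExhaustive (posCone S) (posCone T) φ) :
    ∃ h : X ≃ₜ Y, ∀ f : C(Y, ℤ), f ∈ cob S → f.comp (h : C(X, Y)) ∈ cob T := by
  have h₀ : MatchedCodes T S (fun x y => φ y = x) (Empty.elim : Empty → X) (Empty.elim : Empty → Y)
      (fun _ => 0) (fun _ => 0) := by
    refine ⟨IsLocallyConstant.const 0, IsLocallyConstant.const 0, fun n => ?_, fun i => i.elim,
      fun i => i.elim⟩
    by_cases hn : n = 0
    · subst hn
      have h1 : (fun _ : X => 0) ⁻¹' {0} = univ := by ext; simp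
      have h2 : (fun _ : Y => 0) ⁻¹' {0} = univ := by ext; simp
      rw [h1, h2, cl_univ, cl_univ]
      exact hφ.map_unit
    · have h1 : (fun _ : X => 0) ⁻¹' {n} = ∅ := by ext; simp [Ne.symm hn]
      have h2 : (fun _ : Y => 0) ⁻¹' {n} = ∅ := by ext; simp [Ne.symm hn]
      rw [h1, h2, cl_empty, cl_empty, map_zero]
  obtain ⟨h, hh, -, -⟩ := exists_homeo_of_matchedCodes hT hS (hφ.coneLT_map hT hS) hex h₀
  refine ⟨h, fun f hf => ?_⟩
  rw [← QuotientAddGroup.eq_zero_iff] at hf ⊢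
  rw [hh, hf, map_zero]

/-- A homeomorphism in `trivialHomeos T` preserving a finite clopen partition, fixing one point and
moving a second one to any other point of the same piece. -/
theorem IsMinimalHomeo.exists_mem_trivialHomeos [IsCantorSpace X] {T : X ≃ₜ X}
    (hT : IsMinimalHomeo T) {c : X → ℕ} (hc : IsLocallyConstant c) {x₀ z z' : X} (hz : z ≠ x₀)
    (hz' : z' ≠ x₀) (hzz : c z = c z') :
    ∃ g ∈ trivialHomeos T, (∀ x, c (g x) = c x) ∧ g x₀ = x₀ ∧ g z = z' := by
  obtain ⟨V, hV, hVs, hVx⟩ : ∃ V : Set X, IsClopen V ∧ (z ∈ V ∧ z' ∈ V) ∧ x₀ ∉ V := by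
    obtain ⟨V, hV, h1, h2⟩ := IsCantorSpace.exists_isClopen_separating hz
    obtain ⟨V', hV', h1', h2'⟩ := IsCantorSpace.exists_isClopen_separating hz'
    exact ⟨V ∪ V', hV.union hV', ⟨Or.inl h1, Or.inr h1'⟩, by simp [h2, h2']⟩
  -- The back-and-forth is run for the identity of the dimension group. Refining by `V` gives the
  -- two tracked points different codes.
  have hcV := isLocallyConstant_refineCode hc hV
  have h₀ : MatchedCodes T T (fun x y => AddMonoidHom.id (DimGroup T) y = x)
      (fun i : Bool => if i then z else x₀) (fun i : Bool => if i then z' else x₀)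
      (refineCode c V) (refineCode c V) := by
    refine ⟨hcV, hcV, fun _ => rfl, fun i => ?_, fun i j hij => ?_⟩
    · cases i
      · rfl
      · exact refineCode_eq_iff.2 ⟨hzz, by simp [hVs.1, hVs.2]⟩
    · have := (refineCode_eq_iff.1 hij).2
      cases i <;> cases j <;> simp_all
  obtain ⟨g, hg, hgc, hgi⟩ := exists_homeo_of_matchedCodes hT hT (fun _ h => h)
    (fun a _ b hb hba => ⟨b, rfl, hb, hba⟩) h₀
  refine ⟨g, fun u => QuotientAddGroup.eq_iff_sub_mem.1 (hg u), fun x => ?_, hgi false, hgi true⟩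
  exact (refineCode_eq_iff.1 (hgc x)).1

end BackAndForth

/-! ### Kakutani–Rokhlin towers and replacement by powers of `T` -/

section Towers

variable {X : Type*} [TopologicalSpace X]

theorem IsLocallyConstant.dependent {ι κ : Type*} {c : X → ι} (hc : IsLocallyConstant c)
    {P : ι → X → κ} (hP : ∀ i, IsLocallyConstant (P i)) :
    IsLocallyConstant fun x => P (c x) x := by
  rw [IsLocallyConstant.iff_eventually_eq]
  intro x
  filter_upwards [hc.eventually_eq x, (hP (c x)).eventually_eq x] with y h1 h2
  rw [h1, h2]

/-- Gluing homeomorphisms along a locally constant index. -/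
theorem exists_homeo_glue [CompactSpace X] [T2Space X] {κ : Type*} {P : X → κ}
    (hP : IsLocallyConstant P) (K : κ → X ≃ₜ X) (hbij : Function.Bijective fun x => K (P x) x) :
    ∃ h : X ≃ₜ X, ∀ x, h x = K (P x) x := by
  have hcont : Continuous (Equiv.ofBijective _ hbij) := by
    rw [continuous_iff_continuousAt]
    intro x
    refine ((K (P x)).continuous.continuousAt (x := x)).congr ?_
    filter_upwards [hP.eventually_eq x] with y hy
    simp [hy]
  exact ⟨hcont.homeoOfEquivCompactToT2, fun x => rfl⟩

/-- A Kakutani–Rokhlin partition for `R` with roof `F`, encoded by a height function `j` and a code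
`c` refining a given code `d`. -/
theorem IsMinimalHomeo.exists_tower [CompactSpace X] {R : X ≃ₜ X} (hR : IsMinimalHomeo R)
    {F : Set X} (hF : IsClopen F) (hne : F.Nonempty) {d : X → ℕ} (hd : IsLocallyConstant d)
    (hdF : ∀ u v, d u = d v → (u ∈ F ↔ v ∈ F)) :
    ∃ j c : X → ℕ, IsLocallyConstant j ∧ IsLocallyConstant c ∧ (∀ x ∈ F, j (R x) = 0) ∧
      (∀ x ∉ F, j (R x) = j x + 1) ∧ (∀ x, ∀ n < j x, (R ^ (n + 1) : X ≃ₜ X)⁻¹ x ∉ F) ∧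
      (∀ u v, c u = c v → j u = j v) ∧ (∀ u v, c u = c v → d u = d v) ∧
      (∀ u v, c u = c v → u ∉ F → c (R u) = c (R v)) ∧
      (∀ u v, c u = c v → 0 < j u → c ((R⁻¹ : X ≃ₜ X) u) = c ((R⁻¹ : X ≃ₜ X) v)) := by
  classical
  -- The base is `R '' F`, hence the shift by one: the height of `x` is the least `n` with
  -- `R^{-(n+1)} x` in the roof.
  let P : X → ℕ → Prop := fun x n => (R ^ (n + 1) : X ≃ₜ X)⁻¹ x ∈ F
  have hP (n) : IsClopen {x | P x n} := hF.preimage ((R ^ (n + 1) : X ≃ₜ X)⁻¹).continuous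
  have hex (x) : ∃ n, P x n := by
    obtain ⟨N, hN⟩ := hR.inv.exists_forall_visit hF.isOpen hne
    obtain ⟨i, -, hi⟩ := hN ((R⁻¹ : X ≃ₜ X) x)
    refine ⟨i, ?_⟩
    simp only [P]
    rw [← inv_pow, homeo_pow_apply, Function.iterate_succ_apply]
    exact hi
  let j : X → ℕ := fun x => Nat.find (hex x)
  have hj : IsLocallyConstant j := isLocallyConstant_find hP hex
  have hPs (x n) : P (R x) (n + 1) ↔ P x n := by
    have : (R ^ (n + 1 + 1) : X ≃ₜ X)⁻¹ (R x) = (R ^ (n + 1) : X ≃ₜ X)⁻¹ x := by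
      rw [pow_succ' R (n + 1), mul_inv_rev, Homeomorph.mul_apply]
      exact congrArg _ (R.symm_apply_apply x)
    simp only [P, this]
  have hP0 (x) : P (R x) 0 ↔ x ∈ F := by
    have : (R ^ (0 + 1) : X ≃ₜ X)⁻¹ (R x) = x := by
      rw [zero_add, pow_one]
      exact R.symm_apply_apply x
    simp only [P, this]
  have hj0 (x) (hx : x ∈ F) : j (R x) = 0 := (Nat.find_eq_zero _).2 ((hP0 x).2 hx)
  have hjs (x) (hx : x ∉ F) : j (R x) = j x + 1 := by
    have hex' : ∃ n, P (R x) (n + 1) := (hex x).imp fun n => (hPs x n).2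
    have h1 := Nat.find_comp_succ (hex (R x)) hex' (by rwa [hP0])
    have h2 : Nat.find hex' = Nat.find (hex x) := Nat.find_congr' (hPs x _)
    exact h1.trans (congrArg (· + 1) h2)
  let b : X → X := fun x => (R ^ j x : X ≃ₜ X)⁻¹ x
  have hb (x) : (R ^ j x : X ≃ₜ X) (b x) = x := (R ^ j x : X ≃ₜ X).apply_symm_apply x
  have hbs (x) (hx : x ∉ F) : b (R x) = b x := by
    simp only [b, hjs x hx]
    rw [pow_succ' R (j x), mul_inv_rev, Homeomorph.mul_apply]
    exact congrArg _ (R.symm_apply_apply x)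
  obtain ⟨M, hM⟩ := hj.range_finite.bddAbove
  have hjM (x) : j x < M + 1 := Nat.lt_succ_of_le (hM (mem_range_self x))
  -- Height together with the `d`-name read from the base. The name is shared by the whole column,
  -- so the code moves with `R` inside a tower. Its fixed length covers every height; reading past
  -- the roof does no harm.
  let c₀ : X → ℕ × (Fin (M + 1) → ℕ) := fun x => (j x, fun i => d ((R ^ (i : ℕ) : X ≃ₜ X) (b x)))
  have hc₀ : IsLocallyConstant c₀ := by
    rw [IsLocallyConstant.iff_eventually_eq]
    intro x
    have h1 : ∀ᶠ y in 𝓝 x, ∀ i : Fin (M + 1),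
        d ((R ^ (i : ℕ) : X ≃ₜ X) ((R ^ j x : X ≃ₜ X)⁻¹ y)) =
          d ((R ^ (i : ℕ) : X ≃ₜ X) ((R ^ j x : X ≃ₜ X)⁻¹ x)) :=
      eventually_all.2 fun i => (hd.comp_continuous
        ((R ^ (i : ℕ) : X ≃ₜ X).continuous.comp ((R ^ j x : X ≃ₜ X)⁻¹).continuous)).eventually_eq x
    filter_upwards [hj.eventually_eq x, h1] with y hy h2
    simp only [c₀, b, hy]
    exact Prod.ext rfl (funext h2)
  obtain ⟨e, he⟩ := exists_injective_nat (ℕ × (Fin (M + 1) → ℕ))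
  have hcj (u v) (h : c₀ u = c₀ v) : j u = j v := congrArg Prod.fst h
  have hcd (u v) (h : c₀ u = c₀ v) : d u = d v := by
    have h1 := congrFun (congrArg Prod.snd h) ⟨j u, hjM u⟩
    simp only [c₀] at h1
    rwa [hb, hcj u v h, hb] at h1
  have hcs (u v) (h : c₀ u = c₀ v) (hu : u ∉ F) : c₀ (R u) = c₀ (R v) := by
    have hv : v ∉ F := (hdF u v (hcd u v h)).not.1 hu
    simp only [c₀, hjs u hu, hjs v hv, hbs u hu, hbs v hv]
    have h2 : (c₀ u).2 = (c₀ v).2 := congrArg Prod.snd h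
    exact Prod.ext (congrArg (· + 1) (hcj u v h)) h2
  have hcp (u v) (h : c₀ (R u) = c₀ (R v)) (hu : 0 < j (R u)) : c₀ u = c₀ v := by
    have hu' : u ∉ F := fun h0 => by
      rw [hj0 u h0] at hu
      exact lt_irrefl _ hu
    have hv' : v ∉ F := fun h0 => by
      rw [hcj _ _ h, hj0 v h0] at hu
      exact lt_irrefl _ hu
    have h1 := hcj _ _ h
    have h2 := congrArg Prod.snd h
    simp only [c₀, hbs u hu', hbs v hv'] at h2
    rw [hjs u hu', hjs v hv'] at h1
    exact Prod.ext (Nat.succ_injective h1) h2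
  refine ⟨j, e ∘ c₀, hj, hc₀.comp e, hj0, hjs, fun x n hn => Nat.find_min (hex x) hn,
    fun u v h => hcj u v (he h), fun u v h => hcd u v (he h),
    fun u v h hu => congrArg e (hcs u v (he h) hu), fun u v h hu => congrArg e (hcp _ _ ?_ ?_)⟩
  · have h1 : R ((R⁻¹ : X ≃ₜ X) u) = u := R.apply_symm_apply u
    have h2 : R ((R⁻¹ : X ≃ₜ X) v) = v := R.apply_symm_apply v
    rw [h1, h2]
    exact he h
  · have h1 : R ((R⁻¹ : X ≃ₜ X) u) = u := R.apply_symm_apply u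
    rwa [h1]

/-- Near `x`, the map `R` is a fixed positive power of `T`. -/
def IsLocalPower (T : X ≃ₜ X) (R : X → X) (x : X) : Prop :=
  ∃ k, 0 < k ∧ ∀ᶠ y in 𝓝 x, R y = T^[k] y

theorem IsLocalPower.congr {T : X ≃ₜ X} {R R' : X → X} {x : X} (h : IsLocalPower T R x)
    (he : ∀ᶠ y in 𝓝 x, R' y = R y) : IsLocalPower T R' x := by
  obtain ⟨k, hk, hx⟩ := h
  refine ⟨k, hk, ?_⟩
  filter_upwards [hx, he] with y h1 h2
  rw [h2, h1]

/-- Replace `R` on the set `E` by positive powers of `T`, with the same images of the pieces of a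
clopen partition. -/
theorem IsMinimalHomeo.exists_power_on [CompactSpace X] [T2Space X] {T R : X ≃ₜ X}
    (hT : IsMinimalHomeo T) (hR : R ∈ trivialHomeos T) {c : X → ℕ} (hc : IsLocallyConstant c)
    {E : Set X} (hcE : ∀ u v, c u = c v → (u ∈ E ↔ v ∈ E)) :
    ∃ γ ∈ trivialHomeos T, (∀ x, c ((R⁻¹ : X ≃ₜ X) (γ x)) = c x) ∧ (∀ x ∉ E, γ x = R x) ∧
      ∀ x ∈ E, IsLocalPower T γ x := by
  let K : Option ℕ → X ≃ₜ X := fun o => o.elim R fun n => T ^ n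
  have hRR (x) : (R⁻¹ : X ≃ₜ X) (R x) = x := R.symm_apply_apply x
  have hRR' (x) : R ((R⁻¹ : X ≃ₜ X) x) = x := R.apply_symm_apply x
  -- A piece and its image under `R` have the same class, so the queue argument maps one onto the
  -- other by positive powers of `T`. The value `none` means that `R` is kept.
  have key (i : ℕ) : ∃ P : X → Option ℕ, IsLocallyConstant P ∧
      BijOn (fun x => K (P x) x) (c ⁻¹' {i}) (R '' (c ⁻¹' {i})) ∧
      (∀ x, c x = i → x ∈ E → ∃ n, 0 < n ∧ P x = some n) ∧
      (∀ x, c x = i → x ∉ E → P x = none) := by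
    have hi : IsClopen (c ⁻¹' {i}) := hc.isClopen_fiber i
    by_cases hx : ∃ x, c x = i ∧ x ∈ E
    · obtain ⟨x, hxi, hxE⟩ := hx
      obtain ⟨p, hp, hp0, hpb⟩ := hT.exists_bijOn_of_cl_eq hi
        ⟨R.isClosed_image.2 hi.isClosed, R.isOpen_image.2 hi.isOpen⟩
        (cl_image_of_mem_trivialHomeos hR hi).symm
      refine ⟨fun x => some (p x), hp.comp some, ?_, fun y _ _ => ⟨p y, hp0 y, rfl⟩,
        fun y hy hyE => (hyE ((hcE x y (hxi.trans hy.symm)).1 hxE)).elim⟩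
      refine hpb.congr fun y _ => ?_
      exact (homeo_pow_apply T _ _).symm
    · push Not at hx
      exact ⟨fun _ => none, IsLocallyConstant.const none, R.injective.injOn.bijOn_image,
        fun y hy hyE => (hx y hy hyE).elim, fun _ _ _ => rfl⟩
  choose P hP hPb hPE hPE' using key
  have hcR (x) : c ((R⁻¹ : X ≃ₜ X) (K (P (c x) x) x)) = c x := by
    obtain ⟨y, hy, he⟩ := (hPb (c x)).mapsTo (rfl : c x = c x)
    dsimp only at he
    rw [← he, hRR]
    exact hy
  obtain ⟨γ, hγ⟩ := exists_homeo_glue (hc.dependent hP) K (by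
    constructor
    · intro x y hxy
      have hxy : K (P (c x) x) x = K (P (c y) y) y := hxy
      have h1 : c x = c y := by rw [← hcR x, ← hcR y, hxy]
      refine (hPb (c x)).injOn (rfl : c x = c x) h1.symm ?_
      simpa [h1] using hxy
    · intro y
      obtain ⟨x, hx, hxy⟩ := (hPb (c ((R⁻¹ : X ≃ₜ X) y))).surjOn ⟨_, rfl, hRR' y⟩
      have hx : c x = c ((R⁻¹ : X ≃ₜ X) y) := hx
      exact ⟨x, by simpa [hx] using hxy⟩)
  refine ⟨γ, mem_trivialHomeos_of_pieces (hc.dependent hP) (K := K) ?_ hγ, fun x => ?_,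
    fun x hx => ?_, fun x hx => ?_⟩
  · rintro (_ | n)
    · exact hR
    · exact pow_mem (self_mem_trivialHomeos T) n
  · rw [hγ, hcR]
  · rw [hγ, hPE' (c x) x rfl hx]
    rfl
  · obtain ⟨n, hn, hxn⟩ := hPE (c x) x rfl hx
    refine ⟨n, hn, ?_⟩
    filter_upwards [(hc.dependent hP).eventually_eq x] with y hy
    rw [hγ, hy, hxn]
    exact homeo_pow_apply T n y

end Towers

/-! ### One correction step -/

section Step

variable {X Y : Type*} [TopologicalSpace X] [TopologicalSpace Y]

/-- Conjugate `R`, by a homeomorphism `k` preserving a fine code `c`, to a map that is locally a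
positive power of `T` off a smaller set `F'`. -/
theorem IsMinimalHomeo.exists_conj_isLocalPower [IsCantorSpace X] {T R : X ≃ₜ X}
    (hT : IsMinimalHomeo T) (hR : IsMinimalHomeo R) (hRT : R ∈ trivialHomeos T) {x₀ x₁ : X}
    (hTx : T x₁ = x₀) (hRx : R x₁ = x₀) {F : Set X} (hx₁ : x₁ ∈ F)
    (hLP : ∀ x ∉ F, IsLocalPower T R x) {d : X → ℕ} (hd : IsLocallyConstant d)
    (hdF : ∀ u v, d u = d v → (u ∈ F ↔ v ∈ F)) :
    ∃ k ∈ trivialHomeos T, ∃ c : X → ℕ, IsLocallyConstant c ∧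
      (∀ u v, c u = c v → d u = d v) ∧
      (∀ u v, c u = c v → d u ≠ d x₁ → c (R u) = c (R v)) ∧
      (∀ x, c (k x) = c x) ∧ k x₀ = x₀ ∧ k x₁ = x₁ ∧
      (∀ x ∉ F, k (R x) = R (k x)) ∧
      ∀ x, d x ≠ d x₁ → IsLocalPower T (fun y => k.symm (R (k y))) x := by
  let F' : Set X := {x | d x = d x₁}
  have hF' : IsClopen F' := hd.isClopen_fiber _
  have hFF' : F' ⊆ F := fun x hx => (hdF x x₁ hx).2 hx₁
  have hdF' (u v) (h : d u = d v) : u ∈ F' ↔ v ∈ F' := by simp [F', h]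
  obtain ⟨j, c, hj, hc, hj0, hjs, hjF, hcj, hcd, hcs, hcp⟩ :=
    hR.exists_tower hF' ⟨x₁, rfl⟩ hd hdF'
  have hcF' (u v) (h : c u = c v) : u ∈ F' ↔ v ∈ F' := hdF' u v (hcd u v h)
  have hcF (u v) (h : c u = c v) : u ∈ F ↔ v ∈ F := hdF u v (hcd u v h)
  -- `R` is changed only on `F \ F'`: off `F` it is already a local power of `T`, and on the new
  -- roof `F'` nothing is required.
  obtain ⟨γ, hγT, hγc, hγR, hγP⟩ := hT.exists_power_on hRT hc (E := F \ F')
    fun u v h => and_congr (hcF u v h) (not_congr (hcF' u v h))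
  have hRR' (x) : R ((R⁻¹ : X ≃ₜ X) x) = x := R.apply_symm_apply x
  have hγP' (x) (hx : x ∉ F') : IsLocalPower T γ x := by
    by_cases hxF : x ∈ F
    · exact hγP x ⟨hxF, hx⟩
    · refine (hLP x hxF).congr ?_
      filter_upwards [hc.eventually_eq x] with y hy
      exact hγR y fun h => hxF ((hcF y x hy).1 h.1)
  -- one step up or down the towers, for `R` and `γ`
  have up (α : X ≃ₜ X) (hα : α = R ∨ α = γ) (u v) (h : c u = c v) (hu : u ∉ F') :
      c (α u) = c (R v) := by
    rcases hα with rfl | rfl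
    · exact hcs u v h hu
    · have h1 := hcs ((R⁻¹ : X ≃ₜ X) (α u)) v ((hγc u).trans h)
        ((hcF' _ _ (hγc u)).not.2 hu)
      rwa [hRR'] at h1
  have down (α : X ≃ₜ X) (hα : α = R ∨ α = γ) (u v) (h : c u = c v) (hu : 0 < j u) :
      c ((α⁻¹ : X ≃ₜ X) u) = c ((R⁻¹ : X ≃ₜ X) v) := by
    rcases hα with rfl | rfl
    · exact hcp u v h hu
    · rw [← hcp u v h hu, ← hγc]
      congr 2
      exact α.apply_symm_apply u
  have hjinv (x) (hx : 0 < j x) : j ((R⁻¹ : X ≃ₜ X) x) + 1 = j x := by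
    have h1 : (R⁻¹ : X ≃ₜ X) x ∉ F' := fun h => by
      have := hj0 _ h
      rw [hRR'] at this
      omega
    rw [← hjs _ h1, hRR']
  have hjpow (x m) (hm : m ≤ j x) : j ((R ^ m : X ≃ₜ X)⁻¹ x) = j x - m := by
    induction m with
    | zero => rfl
    | succ m ih =>
      have ih := ih (by omega)
      have h1 := hjinv ((R ^ m : X ≃ₜ X)⁻¹ x) (by omega)
      rw [pow_succ, mul_inv_rev, Homeomorph.mul_apply]
      omega
  have downs (α : X ≃ₜ X) (hα : α = R ∨ α = γ) (x m) (hm : m ≤ j x) :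
      c ((α ^ m : X ≃ₜ X)⁻¹ x) = c ((R ^ m : X ≃ₜ X)⁻¹ x) := by
    induction m with
    | zero => rfl
    | succ m ih =>
      have ih := ih (by omega)
      rw [pow_succ, mul_inv_rev, Homeomorph.mul_apply, pow_succ, mul_inv_rev, Homeomorph.mul_apply]
      refine down α hα _ _ ih ?_
      rw [hcj _ _ ih, hjpow x m (by omega)]
      omega
  have ups (α : X ≃ₜ X) (hα : α = R ∨ α = γ) (u v m) (h : c u = c v)
      (hv : ∀ i < m, (R ^ i : X ≃ₜ X) v ∉ F') :
      c ((α ^ m : X ≃ₜ X) u) = c ((R ^ m : X ≃ₜ X) v) := by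
    induction m with
    | zero => exact h
    | succ m ih =>
      have ih := ih fun i hi => hv i (by omega)
      rw [pow_succ', Homeomorph.mul_apply, pow_succ', Homeomorph.mul_apply]
      exact up α hα _ _ ih ((hcF' _ _ ih).not.2 (hv m (by omega)))
  have hcancel (x) {i J : ℕ} (hi : i < J) :
      (R ^ i : X ≃ₜ X) ((R ^ J : X ≃ₜ X)⁻¹ x) = (R ^ (J - i - 1 + 1) : X ≃ₜ X)⁻¹ x := by
    rw [← Homeomorph.mul_apply]
    congr 2
    obtain ⟨e, rfl⟩ := Nat.exists_eq_add_of_lt hi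
    rw [show i + e + 1 - i - 1 + 1 = e + 1 by omega, show i + e + 1 = (e + 1) + i by omega, pow_add]
    group
  have hroof (x i) (hi : i < j x) : (R ^ i : X ≃ₜ X) ((R ^ j x : X ≃ₜ X)⁻¹ x) ∉ F' := by
    rw [hcancel x hi]
    exact hjF x _ (by omega)
  -- `R` and `γ` climb the same towers as far as codes can tell, so going down by one, applying a
  -- code-preserving map and going up by the other preserves the code.
  have conj_code (α β κ : X ≃ₜ X) (hα : α = R ∨ α = γ) (hβ : β = R ∨ β = γ)
      (hκ : ∀ x, c (κ x) = c x) (x) :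
      c ((β ^ j x : X ≃ₜ X) (κ ((α ^ j x : X ≃ₜ X)⁻¹ x))) = c x := by
    rw [ups β hβ _ ((R ^ j x : X ≃ₜ X)⁻¹ x) (j x) ((hκ _).trans (downs α hα x _ le_rfl)) (hroof x)]
    exact congrArg c ((R ^ j x : X ≃ₜ X).apply_symm_apply x)
  -- the points to be matched in the base
  let z : X := (γ ^ j x₁ : X ≃ₜ X)⁻¹ x₁
  let z' : X := (R ^ j x₁ : X ≃ₜ X)⁻¹ x₁
  have hzz : c z = c z' := downs γ (Or.inr rfl) x₁ _ le_rfl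
  have hz'1 : (R ^ j x₁ : X ≃ₜ X) z' = x₁ := (R ^ j x₁ : X ≃ₜ X).apply_symm_apply x₁
  have hz1 : (γ ^ j x₁ : X ≃ₜ X) z = x₁ := (γ ^ j x₁ : X ≃ₜ X).apply_symm_apply x₁
  have hz' : z' ≠ x₀ := by
    intro h
    rw [h, homeo_pow_apply, ← hRx, ← Function.iterate_succ_apply] at hz'1
    exact hR.iterate_ne (Nat.succ_pos _) x₁ hz'1
  -- Otherwise `γ` climbs from `x₀ = T x₁` to `x₁` below the roof by positive powers of `T`, and
  -- `x₁` would be `T`-periodic.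
  have hz : z ≠ x₀ := by
    intro h
    have hpow (m) (hm : m ≤ j x₁) : ∃ N, (γ ^ m : X ≃ₜ X) z = T^[N] z := by
      induction m with
      | zero => exact ⟨0, rfl⟩
      | succ m ih =>
        obtain ⟨N, hN⟩ := ih (by omega)
        have h1 := ups γ (Or.inr rfl) z z' m hzz fun i hi => hroof x₁ i (by omega)
        obtain ⟨n, -, hn⟩ := hγP' ((γ ^ m : X ≃ₜ X) z)
          ((hcF' _ _ h1).not.2 (hroof x₁ m (by omega)))
        refine ⟨n + N, ?_⟩
        rw [pow_succ', Homeomorph.mul_apply, hn.self_of_nhds, hN, Function.iterate_add_apply]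
    obtain ⟨N, hN⟩ := hpow _ le_rfl
    rw [hz1, h, ← hTx, ← Function.iterate_succ_apply] at hN
    exact hT.iterate_ne (Nat.succ_pos _) x₁ hN.symm
  obtain ⟨g, hgT, hgc, hg0, hgz⟩ := hT.exists_mem_trivialHomeos hc hz hz' hzz
  have hgc' (x) : c ((g⁻¹ : X ≃ₜ X) x) = c x := by
    rw [← hgc]
    exact congrArg c (g.apply_symm_apply x)
  have hkc := conj_code γ R g (Or.inr rfl) (Or.inl rfl) hgc
  have hkc' := conj_code R γ g⁻¹ (Or.inl rfl) (Or.inr rfl) hgc'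
  -- Go down to the base by `γ`, apply `g`, and climb back by `R`. Below the roof this intertwines
  -- `γ` with `R`. The choice of `g` makes it fix `x₀`, which is in the base, and `x₁`, which is on
  -- the roof.
  let K : ℕ → X ≃ₜ X := fun n => R ^ n * g * (γ ^ n)⁻¹
  have hKK (x) : K (j x) ((γ ^ j x : X ≃ₜ X) ((g⁻¹ : X ≃ₜ X) ((R ^ j x : X ≃ₜ X)⁻¹ x))) = x := by
    have : (K (j x) * (γ ^ j x * (g⁻¹ * (R ^ j x)⁻¹)) : X ≃ₜ X) x = x := by
      have : (K (j x) * (γ ^ j x * (g⁻¹ * (R ^ j x)⁻¹)) : X ≃ₜ X) = 1 := by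
        simp only [K]; group
      rw [this]; rfl
    exact this
  obtain ⟨k, hk⟩ := exists_homeo_glue hj K (by
    constructor
    · intro x y hxy
      have hxy : K (j x) x = K (j y) y := hxy
      have h1 : c x = c y := by
        have h2 := hkc x
        have h3 := hkc y
        exact h2.symm.trans ((congrArg c hxy).trans h3)
      rw [hcj _ _ h1] at hxy
      exact (K (j y)).injective hxy
    · intro y
      refine ⟨(γ ^ j y : X ≃ₜ X) ((g⁻¹ : X ≃ₜ X) ((R ^ j y : X ≃ₜ X)⁻¹ y)), ?_⟩
      dsimp only
      rw [hcj _ _ (hkc' y)]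
      exact hKK y)
  have hck (x) : c (k x) = c x := by
    rw [hk]
    exact hkc x
  have hkγ (x) (hx : x ∉ F') : k (γ x) = R (k x) := by
    have h1 : j (γ x) = j x + 1 := by
      rw [hcj _ _ (up γ (Or.inr rfl) x x rfl hx), hjs x hx]
    rw [hk, hk, h1, ← Homeomorph.mul_apply, ← Homeomorph.mul_apply]
    congr 1
    simp only [K]
    rw [pow_succ' γ, pow_succ' R]
    group
  refine ⟨k, mem_trivialHomeos_of_pieces hj (K := K) (fun n => mul_mem (mul_mem (pow_mem hRT n) hgT)
    (inv_mem (pow_mem hγT n))) hk, c, hc, hcd, hcs, hck, ?_, ?_, fun x hx => ?_, fun x hx => ?_⟩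
  · rw [hk, ← hRx, hj0 x₁ rfl, hRx]
    exact hg0
  · rw [hk]
    have : K (j x₁) x₁ = (R ^ j x₁ : X ≃ₜ X) (g z) := rfl
    rw [this, hgz, hz'1]
  · rw [← hkγ x fun h => hx (hFF' h), hγR x fun h => hx h.1]
  · refine (hγP' x hx).congr ?_
    filter_upwards [hF'.compl.isOpen.mem_nhds hx] with y hy
    rw [← hkγ y hy, k.symm_apply_apply]

end Step

/-! ### The limit of the corrections, and the implication 3 → 1 -/

section Speedup

variable {X Y : Type*} [TopologicalSpace X] [TopologicalSpace Y]

/-- A stage of the construction of a speedup conjugate to `S`: the conjugate of `S` by `h` is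
locally a positive power of `T` off the preimage of `E`. -/
structure SpeedupStage (T S : X ≃ₜ X) (x₀ x₁ y₁ : X) where
  h : X ≃ₜ X
  c : X → ℕ
  E : Set X
  h_mem : h ∈ trivialHomeos T
  h_x₀ : h x₀ = x₀
  h_x₁ : h x₁ = y₁
  mem_E : y₁ ∈ E
  c_loc : IsLocallyConstant c
  c_E : ∀ u v, c u = c v → (u ∈ E ↔ v ∈ E)
  power : ∀ x, h x ∉ E → IsLocalPower T (fun y => h.symm (S (h y))) x

/-- The correction step, applied to the current conjugate `R` with a code recording the old code and
`A`, each seen through `s.h`, and also `A` in the source. Agreement of old and new maps up to the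
new code gives convergence; the clauses on `A` make codes separate points on both sides and shrink
`E` to `y₁`; the last two clauses make the conjugates stabilize and pass to the limit. -/
theorem SpeedupStage.exists_next [IsCantorSpace X] {T S : X ≃ₜ X} (hT : IsMinimalHomeo T)
    (hS : IsMinimalHomeo S) (hST : S ∈ trivialHomeos T) {x₀ x₁ y₁ : X} (hTx : T x₁ = x₀)
    (hSy : S y₁ = x₀) (s : SpeedupStage T S x₀ x₁ y₁) {A : Set X} (hA : IsClopen A) :
    ∃ s' : SpeedupStage T S x₀ x₁ y₁,
      (∀ u v, s'.c u = s'.c v → s.c u = s.c v) ∧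
      (∀ x, s'.c (s'.h x) = s'.c (s.h x)) ∧
      (∀ u v, s'.c u = s'.c v → (u ∈ A ↔ v ∈ A)) ∧
      (∀ x x', s'.c (s.h x) = s'.c (s.h x') → (x ∈ A ↔ x' ∈ A)) ∧
      (∀ u ∈ s'.E, u ∈ A ↔ y₁ ∈ A) ∧
      s'.E ⊆ s.E ∧
      (∀ x, s.h x ∉ s.E → s'.h.symm (S (s'.h x)) = s.h.symm (S (s.h x))) ∧
      (∀ u v, s'.c u = s'.c v → u ∉ s'.E → s'.c (S u) = s'.c (S v)) := by
  let R : X ≃ₜ X := (s.h.trans S).trans s.h.symm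
  have hRT : R ∈ trivialHomeos T :=
    mul_mem (inv_mem s.h_mem) (mul_mem hST s.h_mem)
  have hsymm : s.h.symm y₁ = x₁ := s.h.symm_apply_eq.2 s.h_x₁.symm
  have hRx : R x₁ = x₀ := by
    change s.h.symm (S (s.h x₁)) = x₀
    rw [s.h_x₁, hSy, s.h.symm_apply_eq, s.h_x₀]
  let d : X → ℕ := refineCode (refineCode (s.c ∘ s.h) A) (s.h ⁻¹' A)
  have hd (u v) (h : d u = d v) :
      s.c (s.h u) = s.c (s.h v) ∧ (u ∈ A ↔ v ∈ A) ∧ (s.h u ∈ A ↔ s.h v ∈ A) := by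
    have h1 := refineCode_eq_iff.1 h
    have h2 := refineCode_eq_iff.1 h1.1
    exact ⟨h2.1, h2.2, h1.2⟩
  have hdl : IsLocallyConstant d := isLocallyConstant_refineCode
    (isLocallyConstant_refineCode (s.c_loc.comp_continuous s.h.continuous) hA)
    (hA.preimage s.h.continuous)
  obtain ⟨k, hkT, c, hc, hcd, hcR, hck, hk0, hk1, hkR, hkP⟩ :=
    hT.exists_conj_isLocalPower (hS.conj s.h) hRT hTx hRx (F := s.h ⁻¹' s.E)
      (by rw [mem_preimage, s.h_x₁]; exact s.mem_E) s.power hdl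
      fun u v h => s.c_E _ _ (hd u v h).1
  have hcd' (u v) (h : c (s.h.symm u) = c (s.h.symm v)) :
      s.c u = s.c v ∧ (s.h.symm u ∈ A ↔ s.h.symm v ∈ A) ∧ (u ∈ A ↔ v ∈ A) := by
    simpa using hd _ _ (hcd _ _ h)
  have hdE (u) (h : d (s.h.symm u) = d x₁) : s.c u = s.c y₁ ∧ (u ∈ A ↔ y₁ ∈ A) := by
    have := hd _ _ h
    rw [s.h_x₁, s.h.apply_symm_apply] at this
    exact ⟨this.1, this.2.2⟩
  refine ⟨
    { h := k.trans s.h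
      c := c ∘ s.h.symm
      E := {y | d (s.h.symm y) = d x₁}
      h_mem := mul_mem s.h_mem hkT
      h_x₀ := by rw [Homeomorph.trans_apply, hk0, s.h_x₀]
      h_x₁ := by rw [Homeomorph.trans_apply, hk1, s.h_x₁]
      mem_E := by simp [hsymm]
      c_loc := hc.comp_continuous s.h.symm.continuous
      c_E := fun u v h => by simp only [mem_ofPred_eq, hcd _ _ h]
      power := fun x hx => hkP x fun h => hx (by
        rw [mem_ofPred_eq, Homeomorph.trans_apply, s.h.symm_apply_apply, hcd _ _ (hck x), h]) },
    fun u v h => (hcd' u v h).1, fun x => ?_, fun u v h => (hcd' u v h).2.2, fun x x' h => ?_,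
    fun u hu => (hdE u hu).2, fun u hu => (s.c_E _ _ (hdE u hu).1).2 s.mem_E, fun x hx => ?_,
    fun u v h hu => ?_⟩
  · simp [hck]
  · have := (hcd' _ _ h).2.1
    simpa using this
  · have := hkR x hx
    change k.symm (R (k x)) = R x
    rw [← this, k.symm_apply_apply]
  · have := hcR _ _ h hu
    simpa [R] using this

/-- A minimal homeomorphism acting trivially on the dimension group of `T` is a strong speedup
of `T`. -/
theorem IsMinimalHomeo.isStrongSpeedup [IsCantorSpace X] {T S : X ≃ₜ X} (hT : IsMinimalHomeo T)
    (hS : IsMinimalHomeo S) (hST : S ∈ trivialHomeos T) : IsStrongSpeedup S T := by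
  obtain ⟨x₀⟩ : Nonempty X := inferInstance
  obtain ⟨x₁, hTx⟩ := T.surjective x₀
  obtain ⟨y₁, hSy⟩ := S.surjective x₀
  have hx₁ : x₁ ≠ x₀ := by
    rintro rfl
    exact hT.iterate_ne one_pos _ hTx
  have hy₁ : y₁ ≠ x₀ := by
    rintro rfl
    exact hS.iterate_ne one_pos _ hSy
  -- Both `x₁` and `y₁` precede `x₀`, under `T` and `S` respectively. Sending `x₁` to `y₁` and
  -- fixing `x₀` makes the conjugate agree with `T` at `x₁`, where continuity of the jump function
  -- may fail.
  obtain ⟨g, hgT, -, hg0, hg1⟩ :=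
    hT.exists_mem_trivialHomeos (IsLocallyConstant.const 0) hx₁ hy₁ rfl
  obtain ⟨e, he⟩ := exists_surjective_nat (TopologicalSpace.Clopens X)
  let s₀ : SpeedupStage T S x₀ x₁ y₁ :=
    { h := g
      c := fun _ => 0
      E := univ
      h_mem := hgT
      h_x₀ := hg0
      h_x₁ := hg1
      mem_E := mem_univ _
      c_loc := IsLocallyConstant.const 0
      c_E := fun _ _ _ => by simp
      power := fun x hx => (hx (mem_univ _)).elim }
  choose next hnext using fun (n : ℕ) (s : SpeedupStage T S x₀ x₁ y₁) =>
    s.exists_next hT hS hST hTx hSy (e n).isClopen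
  let s : ℕ → SpeedupStage T S x₀ x₁ y₁ := fun n => Nat.rec s₀ (fun n s => next n s) n
  have hs (n) := hnext n (s n)
  change ∀ n, (∀ u v, (s (n + 1)).c u = (s (n + 1)).c v → (s n).c u = (s n).c v) ∧
      (∀ x, (s (n + 1)).c ((s (n + 1)).h x) = (s (n + 1)).c ((s n).h x)) ∧
      (∀ u v, (s (n + 1)).c u = (s (n + 1)).c v → (u ∈ e n ↔ v ∈ e n)) ∧
      (∀ x x', (s (n + 1)).c ((s n).h x) = (s (n + 1)).c ((s n).h x') → (x ∈ e n ↔ x' ∈ e n)) ∧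
      (∀ u ∈ (s (n + 1)).E, u ∈ e n ↔ y₁ ∈ e n) ∧
      (s (n + 1)).E ⊆ (s n).E ∧
      (∀ x, (s n).h x ∉ (s n).E →
        (s (n + 1)).h.symm (S ((s (n + 1)).h x)) = (s n).h.symm (S ((s n).h x))) ∧
      (∀ u v, (s (n + 1)).c u = (s (n + 1)).c v → u ∉ (s (n + 1)).E →
        (s (n + 1)).c (S u) = (s (n + 1)).c (S v)) at hs
  choose hsc hsh hsA hsA' hsE hsE' hsR hsS using hs
  have hrefine {m n} (hmn : m ≤ n) {u v} (h : (s n).c u = (s n).c v) : (s m).c u = (s m).c v := by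
    induction n, hmn using Nat.le_induction with
    | base => exact h
    | succ n _ ih => exact ih (hsc n u v h)
  have hEanti : Antitone fun n => (s n).E := antitone_nat_of_succ_le hsE'
  have hsep (x y : X) (h : ∀ n, x ∈ e n → y ∈ e n) : x = y := by
    by_contra hne
    obtain ⟨V, hV, h1, h2⟩ := IsCantorSpace.exists_isClopen_separating hne
    obtain ⟨n, hn⟩ := he ⟨V, hV⟩
    have := h n
    rw [hn] at this
    exact h2 (this h1)
  have hsepc (x y : X) (h : ∀ n, (s n).c x = (s n).c y) : x = y :=
    hsep x y fun n => (hsA n x y (h (n + 1))).1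
  obtain ⟨h, hh⟩ := exists_homeo_of_codes (f := fun n x => (s n).c ((s n).h x))
    (g := fun n => (s n).c) (fun n => (s n).c_loc.comp_continuous (s n).h.continuous)
    (fun n => (s n).c_loc) (fun n => (s n).h.surjective.range_comp (s n).c)
    (fun n x y hxy => by
      have h1 := hsc n _ _ (hsh n x)
      exact h1.symm.trans (hsc n _ _ hxy))
    (fun x x' hx => hsep x x' fun n => (hsA' n x x' (by
      rw [← hsh, ← hsh]
      exact hx (n + 1))).1) hsepc
  have hx0 : h x₀ = x₀ := hsepc _ _ fun n => by rw [hh, (s n).h_x₀]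
  have hx1 : h x₁ = y₁ := hsepc _ _ fun n => by rw [hh, (s n).h_x₁]
  have hE (n x) : h x ∈ (s n).E ↔ (s n).h x ∈ (s n).E := (s n).c_E _ _ (hh n x)
  -- Off `E` of stage `n` the conjugates no longer change. Since `S` respects the codes there, `S (h
  -- x)` and `S` of the stage-`m` image of `x` have the same code for all large `m`, which
  -- identifies the limit.
  have hstable (n x) (hx : h x ∉ (s n).E) :
      h.symm (S (h x)) = (s n).h.symm (S ((s n).h x)) := by
    have h1 {m} (hm : n ≤ m) : h x ∉ (s m).E := fun h0 => hx (hEanti hm h0)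
    have h2 {m} (hm : n ≤ m) :
        (s m).h.symm (S ((s m).h x)) = (s n).h.symm (S ((s n).h x)) := by
      induction m, hm using Nat.le_induction with
      | base => rfl
      | succ m hm ih => rw [hsR m x ((hE m x).not.1 (h1 hm)), ih]
    rw [h.symm_apply_eq]
    -- Compare at a stage beyond both `m` and `n`; the `+ 1` is needed because `S` is known to
    -- respect codes only at successor stages.
    refine hsepc _ _ fun m => hrefine (show m ≤ max m n + 1 by omega) ?_
    have hm : n ≤ max m n + 1 := by omega
    refine (hsS _ _ _ (hh (max m n + 1) x) (h1 hm)).trans (Eq.trans ?_ (hh (max m n + 1) _).symm)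
    rw [← h2 hm]
    exact congrArg _ ((s (max m n + 1)).h.apply_symm_apply _).symm
  have hpower (x) (hx : x ≠ x₁) : IsLocalPower T (fun y => h.symm (S (h y))) x := by
    -- The sets `E` have only `y₁ = h x₁` in common.
    obtain ⟨n, hn⟩ : ∃ n, h x ∉ (s n).E := by
      by_contra hcon
      push Not at hcon
      refine hx (h.injective ?_)
      rw [hx1]
      exact hsep _ _ fun n => (hsE n _ (hcon (n + 1))).1
    refine ((s n).power x ((hE n x).not.1 hn)).congr ?_
    filter_upwards [((s n).c_loc.comp_continuous h.continuous).eventually_eq x] with y hy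
    exact hstable n y (((s n).c_E _ _ hy).not.2 hn)
  have hex (x) : ∃ k, 0 < k ∧ h.symm (S (h x)) = T^[k] x := by
    by_cases hx : x = x₁
    · subst hx
      refine ⟨1, one_pos, ?_⟩
      rw [hx1, hSy, h.symm_apply_eq, Function.iterate_one, hTx, hx0]
    · obtain ⟨k, hk, hkx⟩ := hpower x hx
      exact ⟨k, hk, hkx.self_of_nhds⟩
  choose p hp0 hp using hex
  have hcont (x) (hx : x ≠ x₁) : ContinuousAt p x := by
    obtain ⟨k, -, hk⟩ := hpower x hx
    refine (continuousAt_const (y := k)).congr ?_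
    filter_upwards [hk] with y hy
    -- Orbits being infinite, the chosen exponent is unique, so `p` is constant wherever the power
    -- is.
    exact hT.iterate_injective y (hy.symm.trans (hp y))
  refine ⟨p, hp0, fun x hx y hy => ?_, h, fun x => ?_⟩
  · rw [not_imp_comm.1 (hcont x) hx, not_imp_comm.1 (hcont y) hy]
  · rw [← hp, h.apply_symm_apply]

theorem isStrongSpeedup_of_homeo [IsCantorSpace X] {T : X ≃ₜ X} {S : Y ≃ₜ Y}
    (hT : IsMinimalHomeo T) (hS : IsMinimalHomeo S) (h : X ≃ₜ Y)
    (hh : ∀ f : C(Y, ℤ), f ∈ cob S → f.comp (h : C(X, Y)) ∈ cob T) : IsStrongSpeedup S T := by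
  have hmem : (h.trans S).trans h.symm ∈ trivialHomeos T := by
    intro u
    have := neg_mem (hh _ ⟨u.comp (h.symm : C(Y, X)), rfl⟩)
    convert this using 1
    ext x
    simp
  obtain ⟨p, hp0, hp, k, hk⟩ := hT.isStrongSpeedup (hS.conj h) hmem
  exact ⟨p, hp0, hp, k.trans h, fun x => by simp [hk]⟩

end Speedup

theorem theorem2 {X Y : Type*} [TopologicalSpace X] [TopologicalSpace Y]
    [IsCantorSpace X] [IsCantorSpace Y] (T : X ≃ₜ X) (S : Y ≃ₜ Y)
    (hT : IsMinimalHomeo T) (hS : IsMinimalHomeo S) :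
    List.TFAE [
      IsStrongSpeedup S T,
      ∃ φ : DimGroup S →+ DimGroup T,
        IsUnitalEpi (posCone S) (distUnit S) (posCone T) (distUnit T) φ ∧
          IsExhaustive (posCone S) (posCone T) φ,
      ∃ h : X ≃ₜ Y, ∀ f : C(Y, ℤ), f ∈ cob S → f.comp (h : C(X, Y)) ∈ cob T] := by
  tfae_have 1 → 3 := IsStrongSpeedup.exists_homeo
  tfae_have 3 → 2 := fun ⟨h, hh⟩ => exists_exhaustive_of_homeo hT h hh
  tfae_have 2 → 3 := fun ⟨_, hφ, hex⟩ => exists_homeo_of_exhaustive hT hS hφ hex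
  tfae_have 3 → 1 := fun ⟨h, hh⟩ => isStrongSpeedup_of_homeo hT hS h hh
  tfae_finish
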